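/- Let $\mathfrak{sl}(2)=\mathbb{C}e\oplus\mathbb{C}h\oplus\mathbb{C}f$ with its normalized invariant form $(x,y)=\operatorname{tr}(xy)$, and let $\widehat{\mathfrak{sl}}(2)=\mathfrak{sl}(2)\otimes\mathbb{C}[t,t^{-1}]\oplus\mathbb{C}K$ be the affine Lie algebra, with $K$ central and $[x(m),y(n)]=[x,y](m+n)+m\,\delta_{m+n,0}(x,y)K$, where $x(n)=x\otimes t^n$. Let $k\in\mathbb{C}$ with $k\neq -2$ and $k\neq 0$. Let $V^k(\mathfrak{sl}(2))$ be the universal affine vertex operator algebra of level $k$, that is, the $\widehat{\mathfrak{sl}}(2)$-module induced from the one-dimensional module of $\mathfrak{sl}(2)\otimes\mathbb{C}[t]\oplus\mathbb{C}K$ on which $\mathfrak{sl}(2)\otimes\mathbb{C}[t]$ acts by $0$ and $K$ by $k$, and let $L(0)$ be its Sugawara operator $$L(0)=\frac{1}{2(k+2)}\Big(A_0+2\sum_{n\ge 1}A_n\Big),\qquad A_n=e(-n)f(n)+f(-n)e(n)+\tfrac12 h(-n)h(n).$$ Let $$N^k(\mathfrak{sl}(2))=\{v\in V^k(\mathfrak{sl}(2))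 : h(n)v=0 \text{ for all } n\ge 0\}$$ be the parafermion subalgebra. Then $N^k(\mathfrak{sl}(2))$ is the direct sum of the subspaces $N^k(\mathfrak{sl}(2))_n=\{v\in N^k(\mathfrak{sl}(2)) : L(0)v=nv\}$, $n\in\mathbb{Z}_{\ge 0}$, these are finite-dimensional, and the character $\mathrm{ch}[N^k(\mathfrak{sl}(2))](q)=\operatorname{tr}q^{L(0)}=\sum_{n\ge 0}\dim N^k(\mathfrak{sl}(2))_n\,q^n$ is given, as a formal power series in $q$, by $$\mathrm{ch}[N^k(\mathfrak{sl}(2))](q)=\sum_{n\ge 0}\frac{q^{2n}}{(q)_n^2},\qquad (q)_n=\prod_{i=1}^n(1-q^i).$$ -/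

import Mathlib

noncomputable section

namespace Parafermion

open scoped TensorProduct

attribute [local instance 100] LieRing.ofAssociativeRing

/-- The Lie algebra `sl(2)` of traceless complex `2 × 2` matrices. -/
abbrev sl2 : Type := LieAlgebra.SpecialLinear.sl (Fin 2) ℂ

/-- The Chevalley generator `e`. -/
def e : sl2 := LieAlgebra.SpecialLinear.single 0 1 (by decide) 1

/-- The Chevalley generator `f`. -/
def f : sl2 := LieAlgebra.SpecialLinear.single 1 0 (by decide) 1

/-- The Chevalley generator `h`, which spans the Cartan subalgebra. -/
def h : sl2 := LieAlgebra.SpecialLinear.singleSubSingle 0 1 1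

/-- The normalized invariant form `(x, y) = tr (x y)` on `sl(2)`; here `(h, h) = 2`. -/
def form : LinearMap.BilinForm ℂ sl2 :=
  LinearMap.mk₂ ℂ (fun x y => Matrix.trace (x.1 * y.1))
    (fun x y z => by simp [add_mul]) (fun c x y => by simp)
    (fun x y z => by simp [mul_add]) (fun c x y => by simp)

lemma form_apply (x y : sl2) : form x y = Matrix.trace (x.1 * y.1) := rfl

lemma form_isSymm : form.IsSymm :=
  ⟨fun x y => by simp only [form_apply]; exact Matrix.trace_mul_comm _ _⟩

lemma form_lieInvariant : form.lieInvariant sl2 := by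
  intro x y z
  simp only [form_apply, LieAlgebra.SpecialLinear.sl_bracket]
  rw [sub_mul, mul_sub, Matrix.trace_sub, Matrix.trace_sub, neg_sub, Matrix.mul_assoc,
    Matrix.mul_assoc, Matrix.trace_mul_comm x.1, Matrix.mul_assoc]

lemma neg_form_isSymm : (-form).IsSymm :=
  ⟨fun x y => by simpa using form_isSymm.eq x y⟩

lemma neg_form_lieInvariant : (-form).lieInvariant sl2 := by
  intro x y z
  have := form_lieInvariant x y z
  simp only [LinearMap.neg_apply, this]

/-- The affine Lie algebra `sl(2) ⊗ ℂ[t, t⁻¹] ⊕ ℂ K`, the central extension of the loop algebra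
with `[x tᵐ, y tⁿ] = [x, y] tᵐ⁺ⁿ + m δ_{m+n,0} (x, y) K` (see `lie_mode_mode`).
Mathlib's cocycle attached to a form `Φ` is `(x tᵐ, y tⁿ) ↦ n δ_{m+n,0} Φ (x, y)`,
whence the minus sign. -/
abbrev AffineSl2 : Type :=
  LieAlgebra.ofTwoCocycle (LieAlgebra.LoopAlgebra.twoCocycleOfBilinear ℂ ℤ sl2 (-form)
    neg_form_lieInvariant neg_form_isSymm)

/-- The element `x(n) = x ⊗ tⁿ` of the affine Lie algebra. -/
def mode (x : sl2) (n : ℤ) : AffineSl2 :=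
  ⟨((AddMonoidAlgebra.single n 1 : AddMonoidAlgebra ℂ ℤ) ⊗ₜ[ℂ] x, 0)⟩

/-- The canonical central element `K`. -/
def central : AffineSl2 := ⟨(0, (TrivialLieModule.equiv ℂ _ ℂ).symm 1)⟩

lemma lie_mode_mode (x y : sl2) (m n : ℤ) :
    ⁅mode x m, mode y n⁆ =
      mode ⁅x, y⁆ (m + n) + (if m + n = 0 then (m : ℂ) * form x y else 0) • central := by
  have key : LieAlgebra.LoopAlgebra.residuePairing ℂ ℤ sl2 (-form)
      ((AddMonoidAlgebra.single m 1 : AddMonoidAlgebra ℂ ℤ) ⊗ₜ[ℂ] x)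
      ((AddMonoidAlgebra.single n 1 : AddMonoidAlgebra ℂ ℤ) ⊗ₜ[ℂ] y) =
        if m + n = 0 then (m : ℂ) * form x y else 0 := by
    rw [LieAlgebra.LoopAlgebra.residuePairing_apply_apply]
    simp only [LieAlgebra.LoopAlgebra.toFinsupp_single_tmul]
    rw [Finsupp.sum_single_index (by simp)]
    by_cases hmn : m + n = 0
    · obtain rfl : n = -m := by omega
      simp
    · rw [Finsupp.single_eq_of_ne (by omega)]
      simp [hmn]
  refine congrArg (LieAlgebra.ofProd _) (Prod.ext ?_ ?_)
  · change ⁅_, _⁆ = _ + _ • (0 : LieAlgebra.loopAlgebra ℂ ℤ sl2)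
    rw [smul_zero, add_zero]
    simp only [mode, LieAlgebra.ofProd, Equiv.coe_fn_symm_mk,
      LieAlgebra.ExtendScalars.bracket_tmul, AddMonoidAlgebra.single_mul_single, one_mul]
    rfl
  · change LieAlgebra.LoopAlgebra.residuePairing ℂ ℤ sl2 (-form)
      ((AddMonoidAlgebra.single m 1 : AddMonoidAlgebra ℂ ℤ) ⊗ₜ[ℂ] x)
      ((AddMonoidAlgebra.single n 1 : AddMonoidAlgebra ℂ ℤ) ⊗ₜ[ℂ] y) + 0 - 0 =
        (0 : ℂ) + (if m + n = 0 then (m : ℂ) * form x y else 0) * 1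
    rw [key]
    simp

lemma lie_central (a : AffineSl2) : ⁅a, central⁆ = 0 := by
  refine congrArg (LieAlgebra.ofProd _) (Prod.ext ?_ ?_)
  · exact lie_zero _
  · simp [central, LieAlgebra.ofProd, trivial_lie_zero]

/-- The universal enveloping algebra of the affine Lie algebra. -/
abbrev U : Type := UniversalEnvelopingAlgebra ℂ AffineSl2

/-- The left ideal of `U` generated by all `x(n)` with `n ≥ 0` and by `K - k`. -/
def vacuumIdeal (k : ℂ) : Submodule U U :=
  Submodule.span U
    ({u | ∃ (x : sl2) (n : ℤ), 0 ≤ n ∧ u = UniversalEnvelopingAlgebra.ι ℂ (mode x n)} ∪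
      {UniversalEnvelopingAlgebra.ι ℂ central - algebraMap ℂ U k})

/-- The universal affine vertex algebra `Vᵏ(sl(2))`, as a module over the affine Lie algebra: the
module induced from the one-dimensional representation of `sl(2) ⊗ ℂ[t] ⊕ ℂ K` on which
`sl(2) ⊗ ℂ[t]` acts by `0` and `K` acts by `k`. -/
def V (k : ℂ) : Type := U ⧸ vacuumIdeal k

instance (k : ℂ) : AddCommGroup (V k) := inferInstanceAs (AddCommGroup (U ⧸ vacuumIdeal k))

instance (k : ℂ) : Module U (V k) := inferInstanceAs (Module U (U ⧸ vacuumIdeal k))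

instance (k : ℂ) : Module ℂ (V k) := inferInstanceAs (Module ℂ (U ⧸ vacuumIdeal k))

instance (k : ℂ) : IsScalarTower ℂ U (V k) :=
  inferInstanceAs (IsScalarTower ℂ U (U ⧸ vacuumIdeal k))

/-- The projection of `U` onto its quotient `Vᵏ(sl(2))`. -/
def proj (k : ℂ) : U →ₗ[U] V k := (vacuumIdeal k).mkQ

lemma proj_surjective (k : ℂ) : Function.Surjective (proj k) :=
  Submodule.mkQ_surjective (vacuumIdeal k)

lemma proj_eq_zero (k : ℂ) (u : U) : proj k u = 0 ↔ u ∈ vacuumIdeal k :=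
  Submodule.Quotient.mk_eq_zero (vacuumIdeal k)

/-- The vacuum vector of `Vᵏ(sl(2))`. -/
def vacuum (k : ℂ) : V k := proj k 1

/-- The action of the affine Lie algebra on `Vᵏ(sl(2))`. -/
def act (k : ℂ) (a : AffineSl2) : Module.End ℂ (V k) :=
  Algebra.lsmul ℂ ℂ (V k) (UniversalEnvelopingAlgebra.ι ℂ a)

/-- The mode `x(n)` as an operator on `Vᵏ(sl(2))`. -/
def op (k : ℂ) (x : sl2) (n : ℤ) : Module.End ℂ (V k) := act k (mode x n)

lemma act_apply (k : ℂ) (a : AffineSl2) (v : V k) :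
    act k a v = UniversalEnvelopingAlgebra.ι ℂ a • v := rfl

lemma act_add (k : ℂ) (a b : AffineSl2) : act k (a + b) = act k a + act k b := by
  simp only [act, map_add]

lemma act_smul (k c : ℂ) (a : AffineSl2) : act k (c • a) = c • act k a := by
  simp only [act, map_smul]

lemma act_lie (k : ℂ) (a b : AffineSl2) (v : V k) :
    act k a (act k b v) = act k b (act k a v) + act k ⁅a, b⁆ v := by
  simp only [act_apply, LieHom.map_lie, LieRing.of_associative_ring_bracket, sub_smul, mul_smul]
  abel

lemma op_vacuum (k : ℂ) (x : sl2) (n : ℤ) (hn : 0 ≤ n) : op k x n (vacuum k) = 0 := by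
  rw [op, act_apply, vacuum, ← map_smul, smul_eq_mul, mul_one, proj_eq_zero]
  exact Submodule.subset_span (Or.inl ⟨x, n, hn, rfl⟩)

/-- Every element of the affine Lie algebra is a combination of the `x(n)` and `K`. -/
lemma mode_span (a : AffineSl2) :
    a ∈ Submodule.span ℂ ({b | ∃ x n, b = mode x n} ∪ {central}) := by
  set S := Submodule.span ℂ ({b : AffineSl2 | ∃ x n, b = mode x n} ∪ {central}) with hS
  let i : LieAlgebra.loopAlgebra ℂ ℤ sl2 →ₗ[ℂ] AffineSl2 :=
    { toFun := fun y => ⟨(y, 0)⟩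
      map_add' := fun y z => congrArg (LieAlgebra.ofProd _) (Prod.ext rfl (add_zero _).symm)
      map_smul' := fun c y => congrArg (LieAlgebra.ofProd _) (Prod.ext rfl (smul_zero _).symm) }
  have hi : ∀ y, i y ∈ S := by
    intro y
    induction y using TensorProduct.induction_on with
    | zero => rw [map_zero]; exact zero_mem _
    | add y z hy hz => rw [map_add]; exact add_mem hy hz
    | tmul p x =>
      induction p using AddMonoidAlgebra.induction_linear with
      | zero => rw [TensorProduct.zero_tmul, map_zero]; exact zero_mem _
      | add p q hp hq => rw [TensorProduct.add_tmul, map_add]; exact add_mem hp hq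
      | single n c =>
        have hc : (AddMonoidAlgebra.single n c : AddMonoidAlgebra ℂ ℤ) =
            c • AddMonoidAlgebra.single n 1 := by
          rw [AddMonoidAlgebra.smul_single, smul_eq_mul, mul_one]
        rw [hc, ← TensorProduct.smul_tmul', map_smul]
        exact S.smul_mem c (Submodule.subset_span (Or.inl ⟨x, n, rfl⟩))
  obtain ⟨y, z⟩ := a
  have hyz : (⟨(y, z)⟩ : AffineSl2) = i y + (TrivialLieModule.equiv ℂ _ ℂ z) • central := by
    refine congrArg (LieAlgebra.ofProd _) (Prod.ext ?_ ?_)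
    · change y = y + _ • (0 : LieAlgebra.loopAlgebra ℂ ℤ sl2)
      rw [smul_zero, add_zero]
    · change (TrivialLieModule.equiv ℂ _ ℂ z : ℂ) =
        (0 : ℂ) + (TrivialLieModule.equiv ℂ _ ℂ z : ℂ) * 1
      simp
  rw [hyz]
  exact add_mem (hi y) (S.smul_mem _ (Submodule.subset_span (Or.inr rfl)))

lemma adjoin_U :
    Algebra.adjoin ℂ (Set.range (UniversalEnvelopingAlgebra.ι ℂ : AffineSl2 → U)) = ⊤ := by
  set A := Algebra.adjoin ℂ (Set.range (UniversalEnvelopingAlgebra.ι ℂ : AffineSl2 → U)) with hA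
  let j : AffineSl2 →ₗ⁅ℂ⁆ A :=
    { toFun := fun a => ⟨UniversalEnvelopingAlgebra.ι ℂ a, Algebra.subset_adjoin ⟨a, rfl⟩⟩
      map_add' := fun a b => Subtype.ext (map_add _ a b)
      map_smul' := fun c a => Subtype.ext (map_smul _ c a)
      map_lie' := fun {a b} => Subtype.ext (LieHom.map_lie _ a b) }
  have hid : A.val.comp (UniversalEnvelopingAlgebra.lift ℂ j) = AlgHom.id ℂ U := by
    apply UniversalEnvelopingAlgebra.hom_ext
    ext a
    change ((UniversalEnvelopingAlgebra.lift ℂ j (UniversalEnvelopingAlgebra.ι ℂ a) : A) : U) = _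
    rw [UniversalEnvelopingAlgebra.lift_ι_apply]
    rfl
  refine eq_top_iff.mpr fun u _ => ?_
  have := DFunLike.congr_fun hid u
  rw [AlgHom.id_apply] at this
  rw [← this]
  exact (UniversalEnvelopingAlgebra.lift ℂ j u).2

/-- Central elements of the affine Lie algebra are central in `U`. -/
lemma central_commute (u : U) :
    UniversalEnvelopingAlgebra.ι ℂ central * u = u * UniversalEnvelopingAlgebra.ι ℂ central := by
  have hu : u ∈ Algebra.adjoin ℂ
      (Set.range (UniversalEnvelopingAlgebra.ι ℂ : AffineSl2 → U)) := adjoin_U ▸ Algebra.mem_top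
  induction hu using Algebra.adjoin_induction with
  | mem x hx =>
    obtain ⟨a, rfl⟩ := hx
    have := LieHom.map_lie (UniversalEnvelopingAlgebra.ι ℂ) a central
    rw [lie_central, map_zero, LieRing.of_associative_ring_bracket] at this
    exact (sub_eq_zero.mp this.symm).symm
  | algebraMap r => exact (Algebra.commutes r _).symm
  | add x y _ _ hx hy => rw [mul_add, add_mul, hx, hy]
  | mul x y _ _ hx hy => rw [← mul_assoc, hx, mul_assoc, hy, mul_assoc]

/-- The central element `K` acts on `Vᵏ(sl(2))` by the level `k`. -/
lemma act_central (k : ℂ) (v : V k) : act k central v = k • v := by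
  obtain ⟨u, rfl⟩ := proj_surjective k v
  have hk : proj k
      (u * (UniversalEnvelopingAlgebra.ι ℂ central - algebraMap ℂ U k)) = 0 := by
    rw [proj_eq_zero]
    exact (vacuumIdeal k).smul_mem u (Submodule.subset_span (Or.inr rfl))
  rw [mul_sub, map_sub, sub_eq_zero, ← central_commute, ← Algebra.commutes,
    ← Algebra.smul_def] at hk
  exact hk

/-- Every vector of `Vᵏ(sl(2))` is killed by all `x(n)` with `n` large. -/
lemma locally_finite (k : ℂ) (v : V k) : ∃ N : ℕ, ∀ (x : sl2) (n : ℤ), N ≤ n → op k x n v = 0 := by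
  let S : Submodule ℂ (V k) :=
    { carrier := {v | ∃ N : ℕ, ∀ (x : sl2) (n : ℤ), N ≤ n → op k x n v = 0}
      zero_mem' := ⟨0, fun x n _ => map_zero _⟩
      add_mem' := by
        rintro v w ⟨M, hM⟩ ⟨N, hN⟩
        refine ⟨M + N, fun x n hn => ?_⟩
        rw [map_add, hM x n (by push_cast at hn; omega), hN x n (by push_cast at hn; omega),
          add_zero]
      smul_mem' := by
        rintro c v ⟨M, hM⟩
        exact ⟨M, fun x n hn => by rw [map_smul, hM x n hn, smul_zero]⟩ }
  have hact : ∀ (a : AffineSl2) (w : V k), w ∈ S → act k a w ∈ S := by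
    intro a w hw
    induction mode_span a using Submodule.span_induction with
    | zero =>
      rw [act_apply, map_zero, zero_smul]
      exact zero_mem S
    | add a b _ _ ha hb => rw [act_add]; exact add_mem ha hb
    | smul c a _ ha => rw [act_smul]; exact S.smul_mem c ha
    | mem a ha =>
      rcases ha with ⟨y, m, rfl⟩ | ha
      · obtain ⟨M, hM⟩ := hw
        refine ⟨M + m.natAbs + 1, fun x n hn => ?_⟩
        push_cast at hn
        have hm := abs_le.mp (le_refl |m|)
        have hm0 := abs_nonneg m
        have h1 : op k x n w = 0 := hM x n (by omega)
        have h2 : op k ⁅x, y⁆ (n + m) w = 0 := hM _ _ (by omega)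
        rw [op] at h1 h2 ⊢
        rw [act_lie, h1, map_zero, zero_add, lie_mode_mode, if_neg (by omega), zero_smul,
          add_zero, h2]
      · rw [Set.mem_singleton_iff.mp ha, act_central]
        exact S.smul_mem k hw
  obtain ⟨u, rfl⟩ := proj_surjective k v
  have hall : ∀ u ∈ Algebra.adjoin ℂ (Set.range (UniversalEnvelopingAlgebra.ι ℂ : AffineSl2 → U)),
      ∀ w ∈ S, u • w ∈ S := by
    intro u hu
    induction hu using Algebra.adjoin_induction with
    | mem x hx => obtain ⟨a, rfl⟩ := hx; exact hact a
    | algebraMap r => intro w hw; rw [algebraMap_smul]; exact S.smul_mem r hw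
    | add x y _ _ hx hy => intro w hw; rw [add_smul]; exact add_mem (hx w hw) (hy w hw)
    | mul x y _ _ hx hy => intro w hw; rw [mul_smul]; exact hx _ (hy w hw)
  have hv := hall u (adjoin_U ▸ Algebra.mem_top) (vacuum k)
    ⟨0, fun x n hn => op_vacuum k x n (by simpa using hn)⟩
  rwa [vacuum, ← map_smul, smul_eq_mul, mul_one] at hv

/-- The `n`-th term `e(-n) f(n) + f(-n) e(n) + h(-n) h(n) / 2` of the Sugawara operator. -/
def sugawaraTerm (k : ℂ) (n : ℤ) : Module.End ℂ (V k) :=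
  op k e (-n) * op k f n + op k f (-n) * op k e n + (1 / 2 : ℂ) • (op k h (-n) * op k h n)

lemma sugawaraTerm_finite (k : ℂ) (v : V k) :
    (Function.support fun n : ℕ => sugawaraTerm k (n + 1) v).Finite := by
  obtain ⟨N, hN⟩ := locally_finite k v
  refine (Set.finite_lt_nat N).subset fun n hn => ?_
  by_contra hlt
  have hle : (N : ℤ) ≤ n + 1 := by simp only [Set.mem_ofPred_eq, not_lt] at hlt; omega
  exact hn (by simp [sugawaraTerm, hN _ _ hle])

/-- The sum over all `n ≥ 1` of the operators `sugawaraTerm k n`; on every vector only finitely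
many terms are nonzero. -/
def sugawaraSum (k : ℂ) : Module.End ℂ (V k) where
  toFun v := ∑ᶠ n : ℕ, sugawaraTerm k (n + 1) v
  map_add' v w := by
    simp only [map_add]
    exact finsum_add_distrib (sugawaraTerm_finite k v) (sugawaraTerm_finite k w)
  map_smul' c v := by
    simp only [map_smul, RingHom.id_apply]
    exact (smul_finsum' c (sugawaraTerm_finite k v)).symm

/-- The Virasoro operator `L(0)` on `Vᵏ(sl(2))` for `k ≠ -2`: the zero mode of the Sugawara vector,
`L(0) = 1 / (2 (k + 2)) ∑ₐ ∑ₙ :xₐ(-n) xᵃ(n):`, the sum being over `n ∈ ℤ` and over the dual bases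
`{e, f, h}` and `{f, e, h / 2}` of `sl(2)`. -/
def L0 (k : ℂ) : Module.End ℂ (V k) :=
  (1 / (2 * (k + 2)) : ℂ) • (sugawaraTerm k 0 + (2 : ℂ) • sugawaraSum k)

/-- The parafermion subalgebra `Nᵏ(sl(2))`: all `v` in `Vᵏ(sl(2))` with `h(n) v = 0` for every
`n ≥ 0`. -/
def N (k : ℂ) : Submodule ℂ (V k) := ⨅ (n : ℤ) (_ : 0 ≤ n), LinearMap.ker (op k h n)

lemma mem_N (k : ℂ) (v : V k) : v ∈ N k ↔ ∀ n : ℤ, 0 ≤ n → op k h n v = 0 := by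
  simp [N, Submodule.mem_iInf]

/-- The part of `Nᵏ(sl(2))` of conformal weight `n`. -/
def weightSpace (k : ℂ) (n : ℕ) : Submodule ℂ (V k) :=
  N k ⊓ Module.End.eigenspace (L0 k) (n : ℂ)

/-- The character `tr q^{L(0)} = ∑ₙ dim Nᵏ(sl(2))ₙ qⁿ` of `Nᵏ(sl(2))` as a formal power series in
`q`. -/
def ch (k : ℂ) : PowerSeries ℚ :=
  PowerSeries.mk fun n => (Module.finrank ℂ (weightSpace k n) : ℚ)

/-- The `q`-Pochhammer symbol `(q)ₙ = (1 - q) (1 - q²) ⋯ (1 - qⁿ)` as a formal power series. -/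
def qPoch (n : ℕ) : PowerSeries ℚ := ∏ i ∈ Finset.Icc 1 n, (1 - PowerSeries.X ^ i)

end Parafermion

end

open scoped PowerSeries.WithPiTopology

/-! The space `V k` has a PBW basis: the ordered monomials in the negative modes of h, e, f, applied
to the vacuum, with the h's to the left. For m ≥ 1 the modes h(m), h(-m) form an oscillator with
commutator 2mk, a nonzero scalar because k ≠ 0, and h(m) is locally nilpotent. Hence `V k` is the
direct sum of ker h(m) and im h(-m). The corresponding projections for different m are compatible,
and their composite projects onto a common kernel along a sum of images (`exists_heisProjs`).

Since the h's stand leftmost, the sum of the images of the h(-m) is spanned by the monomials that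
contain an h. So a vector of `N k` is determined by its coefficients at the monomials free of h.
Weight n and h(0)v = 0 restrict these to monomials of weight n with equally many e's and f's, and
there the coefficients are arbitrary (`coeffs_injective`, `coeffs_surjective`). A monomial with m
factors e(-i-1) and m factors f(-j-1) has weight 2m plus the sum of the indices i and j, so these
monomials are counted by q^(2m)/(q)_m^2.

Two inputs need work. The independence half of PBW (`linearIndependent_mon`) comes from a geometric
model. The subspaces of ℂ²[t, t⁻¹] complementary to t⁻¹ℂ²[t⁻¹] are graphs of maps X. The loop
algebra acts on functions of X by vector fields, and adding k times a trace function produces the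
central charge. Dually it acts on distributions, where the delta at X = 0 is a vacuum vector. Words
in negative modes become differential operators at X = 0, and their leading symbols are visible on
monomials in X.

The other input is [L(0), x(n)] = -n x(n) (`L0_op`). Its sums telescope, and a few modes generating
the loop algebra suffice. It makes monomials eigenvectors of L(0), and it shows that the weight
components of a vector of `N k` lie in `N k`. Directness of the sum is automatic for eigenspaces
with distinct eigenvalues. -/

noncomputable section

namespace Parafermion

open scoped TensorProduct

attribute [local instance 100] LieRing.ofAssociativeRing

/-! ### The big cell and the loop algebra action by vector fields -/

/-- Polynomial functions on matrices `X : ℂ²[t] → t⁻¹ℂ²[t⁻¹]`; the variable `(i, j, a, b)` is the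
`(a, b)`-entry of the block of `X` from `t ^ j` to `t ^ (-i - 1)`. -/
abbrev BigCell : Type := MvPolynomial (ℕ × ℕ × Fin 2 × Fin 2) ℂ

abbrev BigCellMat : Type := Matrix (Fin 2) (Fin 2) BigCell

/-- The `(p, q)`-block of the projection of `ℂ²[t, t⁻¹]` onto the graph of `X` along
`t⁻¹ℂ²[t⁻¹]`. -/
def graphProj (p q : ℤ) : BigCellMat :=
  if q < 0 then 0 else if 0 ≤ p then (if p = q then 1 else 0) else
    Matrix.of fun a b => MvPolynomial.X ((-p - 1).toNat, q.toNat, a, b)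

lemma graphProj_of_neg {p q : ℤ} (hq : q < 0) : graphProj p q = 0 := if_pos hq

lemma graphProj_of_nonneg {p q : ℤ} (hp : 0 ≤ p) : graphProj p q = if p = q then 1 else 0 := by
  unfold graphProj
  by_cases hq : q < 0
  · rw [if_pos hq, if_neg (by omega)]
  · rw [if_neg hq, if_pos hp]

/-- An element of `sl(2)` as a matrix of constants. -/
def constMat : sl2 →ₗ[ℂ] BigCellMat where
  toFun x := x.1.map MvPolynomial.C
  map_add' x y := by ext a b; simp
  map_smul' c x := by
    ext a b
    simp [MvPolynomial.smul_eq_C_mul]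

lemma constMat_lie (x y : sl2) :
    constMat ⁅x, y⁆ = constMat x * constMat y - constMat y * constMat x := by
  simp only [constMat, LinearMap.coe_mk, AddHom.coe_mk, LieAlgebra.SpecialLinear.sl_bracket]
  rw [← Matrix.map_mul, ← Matrix.map_mul, ← Matrix.map_sub]
  exact fun a b => map_sub _ a b

lemma graphProj_of_lt {p q : ℤ} (h : q < p) : graphProj p q = 0 := by
  by_cases hq : q < 0
  · exact graphProj_of_neg hq
  · rw [graphProj_of_nonneg (by omega), if_neg (by omega)]

/-- The first factor forces r + n ≥ 0, and triangularity of the projection forces r ≤ q. Composites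
of the projection with x tⁿ are therefore finite sums. -/
lemma graphProj_sum_support (x : BigCellMat) (n p q : ℤ) :
    (Function.support fun r : ℤ => graphProj p (r + n) * x * graphProj r q) ⊆
      Set.Icc (-|n|) q := by
  intro r hr
  have h1 : ¬ r + n < 0 := fun h => hr (by simp [graphProj_of_neg h])
  have h2 : ¬ q < r := fun h => hr (by simp [graphProj_of_lt h])
  have := le_abs_self n
  constructor <;> omega

/-- The `(p, q)`-block of the infinitesimal action of `x tⁿ` on the projection onto the graph. -/
def graphVar (x : BigCellMat) (n p q : ℤ) : BigCellMat :=
  x * graphProj (p - n) q - ∑ᶠ r : ℤ, graphProj p (r + n) * x * graphProj r q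

lemma graphVar_eq (x : BigCellMat) (n p q : ℤ) (B : ℤ) (hB : |n| ≤ B) (hq : q ≤ B) :
    graphVar x n p q =
      x * graphProj (p - n) q -
        ∑ r ∈ Finset.Icc (-B) B, graphProj p (r + n) * x * graphProj r q := by
  rw [graphVar, finsum_eq_sum_of_support_subset]
  refine (graphProj_sum_support x n p q).trans ?_
  rw [Finset.coe_Icc]
  exact Set.Icc_subset_Icc (by omega) hq

lemma graphVar_add (x y : BigCellMat) (n p q : ℤ) :
    graphVar (x + y) n p q = graphVar x n p q + graphVar y n p q := by
  simp only [graphVar_eq _ n p q _ (le_max_left _ _) (le_max_right _ _), mul_add, add_mul,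
    Finset.sum_add_distrib]
  abel

lemma graphVar_smul (c : ℂ) (x : BigCellMat) (n p q : ℤ) :
    graphVar (c • x) n p q = c • graphVar x n p q := by
  simp only [graphVar_eq _ n p q _ (le_max_left _ _) (le_max_right _ _), smul_sub,
    Finset.smul_sum, smul_mul_assoc,
    mul_smul_comm]

/-- The vector field on the big cell given by the infinitesimal action of `x tⁿ`. -/
def field (x : sl2) (n : ℤ) : Derivation ℂ BigCell BigCell :=
  MvPolynomial.mkDerivation ℂ fun v =>
    graphVar (constMat x) n (-(v.1 : ℤ) - 1) v.2.1 v.2.2.1 v.2.2.2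

lemma field_add (x y : sl2) (n : ℤ) : field (x + y) n = field x n + field y n := by
  refine MvPolynomial.derivation_ext fun v => ?_
  simp [field, MvPolynomial.mkDerivation_X, graphVar_add]

lemma field_smul (c : ℂ) (x : sl2) (n : ℤ) : field (c • x) n = c • field x n := by
  refine MvPolynomial.derivation_ext fun v => ?_
  simp [field, MvPolynomial.mkDerivation_X, graphVar_smul]

/-- A derivation applied to the entries of a matrix. -/
def matDer (D : Derivation ℂ BigCell BigCell) : BigCellMat →+ BigCellMat where
  toFun A := A.map D
  map_zero' := by ext; simp
  map_add' A B := by ext; simp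

lemma matDer_apply (D : Derivation ℂ BigCell BigCell) (A : BigCellMat) (a b : Fin 2) :
    matDer D A a b = D (A a b) := rfl

lemma matDer_mul (D : Derivation ℂ BigCell BigCell) (A B : BigCellMat) :
    matDer D (A * B) = matDer D A * B + A * matDer D B := by
  refine Matrix.ext fun a b => ?_
  simp only [matDer_apply, Matrix.mul_apply, Matrix.add_apply, map_sum, Derivation.leibniz,
    smul_eq_mul]
  rw [← Finset.sum_add_distrib]
  refine Finset.sum_congr rfl fun c _ => ?_
  rw [add_comm, mul_comm (B c b)]

lemma matDer_constMat (D : Derivation ℂ BigCell BigCell) (x : sl2) : matDer D (constMat x) = 0 := by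
  ext a b
  simp only [matDer_apply, constMat]
  exact congrArg _ (D.map_algebraMap (x.1 a b))

lemma matDer_trace (D : Derivation ℂ BigCell BigCell) (A : BigCellMat) :
    D A.trace = (matDer D A).trace := by
  simp [Matrix.trace, matDer_apply]

/-- Let P be the projection onto the graph and a = x tⁿ. The image of P moves by a while its kernel
stays fixed, so δP = (1 - P) a P = aP - PaP. The vector field prescribes this only on the coordinate
blocks p < 0 ≤ q; on the other blocks P is constant and aP - PaP vanishes. -/
lemma matDer_graphProj (x : sl2) (n p q : ℤ) :
    matDer (field x n) (graphProj p q) = graphVar (constMat x) n p q := by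
  by_cases hq : q < 0
  · have h0 : ∀ r, graphProj r q = 0 := fun r => graphProj_of_neg hq
    simp [graphVar, h0]
  by_cases hp : 0 ≤ p
  · have h1 : matDer (field x n) (graphProj p q) = 0 := by
      rw [graphProj_of_nonneg hp]
      split_ifs
      · ext a b
        rw [matDer_apply, Matrix.one_apply]
        split_ifs <;> simp
      · exact map_zero _
    rw [h1, graphVar, finsum_eq_single _ (p - n), graphProj_of_nonneg hp, if_pos (by omega),
      one_mul, sub_self]
    intro r hr
    rw [graphProj_of_nonneg hp, if_neg (by omega), zero_mul, zero_mul]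
  · ext a b
    have e1 : (-(((-p - 1).toNat : ℕ) : ℤ) - 1) = p := by omega
    have e2 : ((q.toNat : ℕ) : ℤ) = q := by omega
    rw [matDer_apply, graphProj, if_neg hq, if_neg hp, Matrix.of_apply, field,
      MvPolynomial.mkDerivation_X]
    simp only [e1, e2]

lemma sum_graphProj_shift (x : BigCellMat) (m n p q B : ℤ) (hB : |m| + |n| + |n| ≤ B)
    (hq : q + |n| ≤ B) :
    ∑ r ∈ Finset.Icc (-B) B, graphProj p (r + m) * x * graphProj (r - n) q =
      ∑ r ∈ Finset.Icc (-B) B, graphProj p (r + (m + n)) * x * graphProj r q := by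
  have hs := graphProj_sum_support x (m + n) p q
  have h1 := abs_add_le m n
  have := abs_nonneg m
  have := abs_nonneg n
  have := le_abs_self n
  have := neg_abs_le n
  rw [← finsum_eq_sum_of_support_subset (fun r => graphProj p (r + (m + n)) * x * graphProj r q),
    ← finsum_eq_sum_of_support_subset (fun r => graphProj p (r + m) * x * graphProj (r - n) q),
    ← finsum_comp_equiv (Equiv.addRight n)]
  · refine finsum_congr fun r => ?_
    simp only [Equiv.coe_addRight, add_sub_cancel_right]
    rw [add_assoc, add_comm n m]
  · intro r hr
    have : r - n ∈ Set.Icc (-|m + n|) q := hs (by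
      simp only [Function.mem_support] at hr ⊢
      convert hr using 4
      omega)
    rw [Finset.coe_Icc]
    constructor <;> linarith [this.1, this.2]
  · refine hs.trans ?_
    rw [Finset.coe_Icc]
    exact Set.Icc_subset_Icc (by omega) (by omega)

lemma matDer_graphVar (x y : sl2) (m n p q B : ℤ) (hB : |m| + |n| + |n| ≤ B)
    (hq : q + |m| + |n| ≤ B) :
    matDer (field y n) (graphVar (constMat x) m p q) =
      constMat x * constMat y * graphProj (p - m - n) q
      - ∑ r ∈ Finset.Icc (-B) B,
          constMat x * (graphProj (p - m) (r + n) * constMat y * graphProj r q)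
      - ∑ r ∈ Finset.Icc (-B) B,
          constMat y * (graphProj (p - n) (r + m) * constMat x * graphProj r q)
      + ∑ r ∈ Finset.Icc (-B) B, ∑ s ∈ Finset.Icc (-B) B,
          graphProj p (r + n) * constMat y * graphProj r (s + m) * constMat x * graphProj s q
      - ∑ r ∈ Finset.Icc (-B) B, graphProj p (r + (m + n)) * (constMat x * constMat y) *
          graphProj r q
      + ∑ r ∈ Finset.Icc (-B) B, ∑ s ∈ Finset.Icc (-B) B,
          graphProj p (r + m) * constMat x * graphProj r (s + n) * constMat y * graphProj s q := by
  have hm := abs_nonneg m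
  have hn := abs_nonneg n
  have hm' := le_abs_self m
  rw [graphVar_eq _ m p q B (by omega) (by omega), map_sub, map_sum, matDer_mul, matDer_constMat,
    zero_mul, zero_add, matDer_graphProj, graphVar_eq _ n _ q B (by omega) (by omega)]
  have hsum : ∑ r ∈ Finset.Icc (-B) B,
      matDer (field y n) (graphProj p (r + m) * constMat x * graphProj r q) =
      ∑ r ∈ Finset.Icc (-B) B,
        ((constMat y * (graphProj (p - n) (r + m) * constMat x * graphProj r q)
        - ∑ s ∈ Finset.Icc (-B) B,
          graphProj p (s + n) * constMat y * graphProj s (r + m) * constMat x * graphProj r q)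
        + (graphProj p (r + m) * (constMat x * constMat y) * graphProj (r - n) q
        - ∑ s ∈ Finset.Icc (-B) B,
          graphProj p (r + m) * constMat x * graphProj r (s + n) * constMat y *
            graphProj s q)) := by
    refine Finset.sum_congr rfl fun r _ => ?_
    rw [matDer_mul, matDer_mul, matDer_constMat, mul_zero, add_zero, matDer_graphProj,
      matDer_graphProj, graphVar_eq _ n r q B (by omega) (by omega)]
    congr 1
    · by_cases hr : q < r
      · simp [graphProj_of_lt hr]
      · rw [graphVar_eq _ n p _ B (by omega) (by omega)]
        simp only [sub_mul, Finset.sum_mul, mul_assoc]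
    · simp only [mul_sub, Finset.mul_sum, mul_assoc]
  rw [hsum, Finset.sum_add_distrib, Finset.sum_sub_distrib, Finset.sum_sub_distrib,
    sum_graphProj_shift _ m n p q B (by omega) (by omega)]
  rw [Finset.sum_comm (f := fun r s => graphProj p (s + n) * constMat y * graphProj s (r + m) *
    constMat x * graphProj r q)]
  simp only [mul_sub, Finset.mul_sum, mul_assoc]
  abel

/-- With δ_a P = aP - PaP, the second variation δ_b δ_a P is abP - PabP plus terms symmetric in a
and b, so antisymmetrizing leaves the variation along [a, b]. The order of the bracket is reversed
because functions carry a right action. -/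
lemma field_lie (x y : sl2) (m n : ℤ) : ⁅field y n, field x m⁆ = field ⁅x, y⁆ (m + n) := by
  refine MvPolynomial.derivation_ext fun v => ?_
  obtain ⟨i, j, a, b⟩ := v
  have key : ∀ p q : ℤ, matDer (field y n) (graphVar (constMat x) m p q) -
      matDer (field x m) (graphVar (constMat y) n p q) =
        graphVar (constMat ⁅x, y⁆) (m + n) p q := by
    intro p q
    -- One window [-B, B] large enough to contain the supports of all sums involved, before and
    -- after shifting the index.
    obtain ⟨B, h1, h2⟩ : ∃ B : ℤ, |m| + |n| + |m| + |n| ≤ B ∧ q + |m| + |n| ≤ B :=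
      ⟨_, le_max_left _ _, le_max_right _ _⟩
    have hm := abs_nonneg m
    have hn := abs_nonneg n
    have := abs_add_le m n
    rw [matDer_graphVar x y m n p q B (by omega) (by omega),
      matDer_graphVar y x n m p q B (by omega) (by omega),
      graphVar_eq _ (m + n) p q B (by omega) (by omega), constMat_lie]
    have e1 : p - m - n = p - (m + n) := by omega
    have e2 : p - n - m = p - (m + n) := by omega
    rw [e1, e2, add_comm n m]
    simp only [mul_sub, sub_mul, Finset.sum_sub_distrib, mul_assoc]
    abel
  have := congrFun (congrFun (key (-i - 1) j) a) b
  rw [Derivation.commutator_apply]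
  simpa [field, MvPolynomial.mkDerivation_X, matDer_apply] using this

/-! ### The trace function and the central cocycle -/

/-- The trace of the block `t⁻¹ℂ²[t⁻¹] → ℂ²[t]` of `x tⁿ` composed with `X`. -/
def traceFun (x : sl2) (n : ℤ) : BigCell :=
  ∑ r ∈ Finset.Ico (-n) 0, (constMat x * graphProj r (r + n)).trace

lemma traceFun_add (x y : sl2) (n : ℤ) : traceFun (x + y) n = traceFun x n + traceFun y n := by
  simp [traceFun, add_mul, Finset.sum_add_distrib]

lemma traceFun_smul (c : ℂ) (x : sl2) (n : ℤ) : traceFun (c • x) n = c • traceFun x n := by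
  simp [traceFun, Finset.smul_sum]

lemma traceFun_of_nonpos (x : sl2) {n : ℤ} (hn : n ≤ 0) : traceFun x n = 0 := by
  rw [traceFun, Finset.Ico_eq_empty (by omega), Finset.sum_empty]

lemma sum_Ico_append {M : Type*} [AddCommMonoid M] (θ : ℤ → M) {a b c : ℤ} (hab : a ≤ b)
    (hbc : b ≤ c) :
    ∑ r ∈ Finset.Ico a b, θ r + ∑ r ∈ Finset.Ico b c, θ r = ∑ r ∈ Finset.Ico a c, θ r := by
  rw [← Finset.Ico_union_Ico_eq_Ico hab hbc,
    Finset.sum_union (Finset.Ico_disjoint_Ico_consecutive a b c)]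

/-- Translating the first sum by n gives the range [-(m+n), -n), which is adjacent to [-n, 0). What
sticks out of [-(m+n), 0) lies either below it, where θ vanishes, or in r ≥ 0, where θ is constant.
The latter matters only for m + n = 0, and then gives m copies of t when m > 0. This boundary
contribution is the origin of the central term. -/
lemma sum_Ico_shift {M : Type*} [AddCommMonoid M] (θ : ℤ → M) (m n : ℤ) (t : M)
    (h1 : ∀ r < -(m + n), θ r = 0) (h2 : ∀ r, 0 ≤ r → θ r = if m + n = 0 then t else 0) :
    ∑ r ∈ Finset.Ico (-m) 0, θ (r - n) + ∑ r ∈ Finset.Ico (-n) 0, θ r =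
      ∑ r ∈ Finset.Ico (-(m + n)) 0, θ r + if m + n = 0 then m.toNat • t else 0 := by
  have hshift : ∑ r ∈ Finset.Ico (-m) 0, θ (r - n) = ∑ r ∈ Finset.Ico (-(m + n)) (-n), θ r := by
    have := Finset.sum_Ico_add' θ (-m) 0 (-n)
    rw [show -m + -n = -(m + n) by ring, zero_add] at this
    rw [← this]
    simp only [← sub_eq_add_neg]
  rw [hshift]
  rcases le_or_gt n 0 with hn | hn
  · rw [Finset.Ico_eq_empty (a := -n) (by omega), Finset.sum_empty, add_zero]
    rcases le_or_gt 0 (m + n) with hN | hN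
    · rw [← sum_Ico_append θ (show -(m + n) ≤ 0 by omega) (show 0 ≤ -n by omega)]
      congr 1
      rw [Finset.sum_congr rfl fun r hr => h2 r (Finset.mem_Ico.mp hr).1, Finset.sum_const,
        Int.card_Ico]
      split_ifs with h
      · congr 2
        omega
      · simp
    · rw [Finset.Ico_eq_empty (b := (0 : ℤ)) (by omega), Finset.sum_empty, if_neg (by omega),
        add_zero]
      refine Finset.sum_eq_zero fun r hr => ?_
      rw [h2 r (by have := (Finset.mem_Ico.mp hr).1; omega), if_neg (by omega)]
  · have hlast : (if m + n = 0 then m.toNat • t else 0) = 0 := by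
      split_ifs with h
      · rw [show m.toNat = 0 by omega, zero_smul]
      · rfl
    rw [hlast, add_zero]
    rcases le_or_gt 0 m with hm | hm
    · rw [sum_Ico_append θ (by omega) (by omega)]
    · rw [Finset.Ico_eq_empty (a := -(m + n)) (b := -n) (by omega), Finset.sum_empty, zero_add]
      rcases le_or_gt 0 (m + n) with hN | hN
      · rw [← sum_Ico_append θ (show -n ≤ -(m + n) by omega) (by omega)]
        rw [Finset.sum_eq_zero fun r hr => h1 r (Finset.mem_Ico.mp hr).2, zero_add]
      · rw [Finset.Ico_eq_empty (a := -(m + n)) (by omega), Finset.sum_empty]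
        exact Finset.sum_eq_zero fun r hr => h1 r (by have := (Finset.mem_Ico.mp hr).2; omega)

lemma sum_trace_shift (Y : BigCellMat) (m n : ℤ) :
    ∑ r ∈ Finset.Ico (-m) 0, (Y * graphProj (r - n) (r + m)).trace +
        ∑ r ∈ Finset.Ico (-n) 0, (Y * graphProj r (r + (m + n))).trace =
      ∑ r ∈ Finset.Ico (-(m + n)) 0, (Y * graphProj r (r + (m + n))).trace +
        if m + n = 0 then m.toNat • Y.trace else 0 := by
  have key := sum_Ico_shift (fun r => (Y * graphProj r (r + (m + n))).trace) m n Y.trace ?_ ?_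
  · have e : ∀ r, r - n + (m + n) = r + m := fun r => by ring
    simp only [e] at key
    exact key
  · intro r hr
    rw [graphProj_of_neg (p := r) (show r + (m + n) < 0 by omega), mul_zero, Matrix.trace_zero]
  · intro r hr
    rw [graphProj_of_nonneg hr]
    by_cases h : m + n = 0
    · rw [if_pos (by omega), if_pos h, mul_one]
    · rw [if_neg (by omega), if_neg h, mul_zero, Matrix.trace_zero]

/-- For r ≥ 0 the row r of the projection is that of the identity, so column q meets only r = q and
the rows -n ≤ r < 0. -/
lemma graphVar_of_nonneg (x : BigCellMat) (n p : ℤ) {q : ℤ} (hq : 0 ≤ q) :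
    graphVar x n p q = x * graphProj (p - n) q - graphProj p (q + n) * x -
      ∑ s ∈ Finset.Ico (-n) 0, graphProj p (s + n) * x * graphProj s q := by
  rw [graphVar, finsum_eq_sum_of_support_subset (s := insert q (Finset.Ico (-n) 0)),
    Finset.sum_insert (by simp; omega), graphProj_of_nonneg (p := q) hq, if_pos rfl, mul_one]
  · abel
  · intro r hr
    have h1 : ¬ r + n < 0 := fun h => hr (by simp [graphProj_of_neg h])
    have h2 : r < 0 ∨ r = q := by
      by_contra! h
      exact hr (by simp [graphProj_of_nonneg h.1, h.2])
    simp only [Finset.coe_insert, Finset.coe_Ico, Set.mem_insert_iff, Set.mem_Ico]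
    omega

lemma field_trace (x y : sl2) (m n : ℤ) {r : ℤ} (hr : 0 ≤ r + m) :
    field y n (constMat x * graphProj r (r + m)).trace =
      (constMat x * constMat y * graphProj (r - n) (r + m)).trace
      - (constMat y * constMat x * graphProj r (r + (m + n))).trace
      - ∑ s ∈ Finset.Ico (-n) 0,
        (constMat x * graphProj r (s + n) * constMat y * graphProj s (r + m)).trace := by
  have h1 : (constMat x * (graphProj r (r + m + n) * constMat y)).trace =
      (constMat y * constMat x * graphProj r (r + (m + n))).trace := by
    rw [← Matrix.mul_assoc, Matrix.trace_mul_comm, ← Matrix.mul_assoc, add_assoc]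
  have h2 : (constMat x * ∑ s ∈ Finset.Ico (-n) 0,
        graphProj r (s + n) * constMat y * graphProj s (r + m)).trace =
      ∑ s ∈ Finset.Ico (-n) 0,
        (constMat x * graphProj r (s + n) * constMat y * graphProj s (r + m)).trace := by
    rw [Matrix.mul_sum, Matrix.trace_sum]
    exact Finset.sum_congr rfl fun s _ => by simp only [Matrix.mul_assoc]
  rw [matDer_trace, matDer_mul, matDer_constMat, Matrix.zero_mul, zero_add, matDer_graphProj,
    graphVar_of_nonneg _ _ _ hr, Matrix.mul_sub, Matrix.mul_sub, Matrix.trace_sub,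
    Matrix.trace_sub, h1, h2, ← Matrix.mul_assoc]

lemma field_traceFun (x y : sl2) (m n : ℤ) :
    field y n (traceFun x m) =
      ∑ r ∈ Finset.Ico (-m) 0, (constMat x * constMat y * graphProj (r - n) (r + m)).trace
      - ∑ r ∈ Finset.Ico (-m) 0, (constMat y * constMat x * graphProj r (r + (m + n))).trace
      - ∑ r ∈ Finset.Ico (-m) 0, ∑ s ∈ Finset.Ico (-n) 0,
        (constMat x * graphProj r (s + n) * constMat y * graphProj s (r + m)).trace := by
  rw [traceFun, map_sum, ← Finset.sum_sub_distrib, ← Finset.sum_sub_distrib]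
  refine Finset.sum_congr rfl fun r hr => field_trace x y m n ?_
  have := Finset.mem_Ico.mp hr
  omega

lemma constMat_trace_mul (x y : sl2) :
    (constMat x * constMat y).trace = MvPolynomial.C (form x y) := by
  simp only [constMat, LinearMap.coe_mk, AddHom.coe_mk, form_apply]
  rw [← Matrix.map_mul]
  simp only [Matrix.trace, Matrix.diag_apply, Matrix.map_apply, map_sum]

/-- `traceFun` is the regularized trace tr(a(P - P₀)), with P₀ the projection at X = 0. Varying P
along b gives tr(abP) - tr(aPbP). The quadratic term is symmetric in a and b by cyclicity and drops
out. The linear terms give the trace function of [a, b] up to the boundary terms of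
`sum_trace_shift`, which make up the cocycle. -/
lemma field_traceFun_sub (x y : sl2) (m n : ℤ) :
    field y n (traceFun x m) - field x m (traceFun y n) =
      traceFun ⁅x, y⁆ (m + n) +
        MvPolynomial.C (if m + n = 0 then (m : ℂ) * form x y else 0) := by
  have h1 := sum_trace_shift (constMat x * constMat y) m n
  have h2 := sum_trace_shift (constMat y * constMat x) n m
  have h3 : ∑ r ∈ Finset.Ico (-m) 0, ∑ s ∈ Finset.Ico (-n) 0,
        (constMat x * graphProj r (s + n) * constMat y * graphProj s (r + m)).trace =
      ∑ r ∈ Finset.Ico (-n) 0, ∑ s ∈ Finset.Ico (-m) 0,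
        (constMat y * graphProj r (s + m) * constMat x * graphProj s (r + n)).trace := by
    rw [Finset.sum_comm]
    refine Finset.sum_congr rfl fun r _ => Finset.sum_congr rfl fun s _ => ?_
    rw [mul_assoc, Matrix.trace_mul_comm]
    simp only [mul_assoc]
  rw [field_traceFun, field_traceFun, h3, traceFun, constMat_lie]
  simp only [sub_mul, Matrix.trace_sub, Finset.sum_sub_distrib]
  rw [add_comm n m] at h2 ⊢
  have h4 : MvPolynomial.C (if m + n = 0 then (m : ℂ) * form x y else 0) =
      (if m + n = 0 then m.toNat • (constMat x * constMat y).trace else 0) -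
      (if m + n = 0 then n.toNat • (constMat y * constMat x).trace else (0 : BigCell)) := by
    rw [Matrix.trace_mul_comm (constMat y), constMat_trace_mul]
    split_ifs with h
    · have : (m : ℂ) = (m.toNat : ℂ) - (n.toNat : ℂ) := by
        have : m = (m.toNat : ℤ) - (n.toNat : ℤ) := by omega
        exact_mod_cast congrArg (Int.cast : ℤ → ℂ) this
      rw [this, sub_mul, map_sub, ← nsmul_eq_mul, ← nsmul_eq_mul, map_nsmul, map_nsmul]
    · simp
  rw [h4]
  linear_combination h1 - h2

/-- The operator by which `x tⁿ` acts on functions on the big cell twisted by the level. -/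
def cellOp (k : ℂ) (n : ℤ) : sl2 →ₗ[ℂ] Module.End ℂ BigCell where
  toFun x := (field x n : BigCell →ₗ[ℂ] BigCell) + k • LinearMap.mulLeft ℂ (traceFun x n)
  map_add' x y := by
    refine LinearMap.ext fun p => ?_
    simp only [field_add, traceFun_add, LinearMap.add_apply, LinearMap.smul_apply,
      LinearMap.mulLeft_apply, add_mul, smul_add, Derivation.coe_add_linearMap]
    abel
  map_smul' c x := by
    refine LinearMap.ext fun p => ?_
    simp only [field_smul, traceFun_smul, LinearMap.add_apply, LinearMap.smul_apply,
      LinearMap.mulLeft_apply, smul_mul_assoc, smul_add, Derivation.coe_smul_linearMap,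
      smul_comm c k, RingHom.id_apply]

lemma cellOp_apply (k : ℂ) (n : ℤ) (x : sl2) (p : BigCell) :
    cellOp k n x p = field x n p + k • (traceFun x n * p) := rfl

/-- Multiplication operators commute with each other, so besides the bracket of vector fields only k
times the difference in `field_traceFun_sub` remains. -/
lemma cellOp_lie (k : ℂ) (x y : sl2) (m n : ℤ) :
    cellOp k n y * cellOp k m x - cellOp k m x * cellOp k n y =
      cellOp k (m + n) ⁅x, y⁆ + (if m + n = 0 then (m : ℂ) * form x y else 0) • (k • 1) := by
  refine LinearMap.ext fun p => ?_
  have h1 := DFunLike.congr_fun (field_lie x y m n) p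
  have h2 := field_traceFun_sub x y m n
  rw [Derivation.commutator_apply] at h1
  rw [LinearMap.sub_apply, LinearMap.add_apply, Module.End.mul_apply, Module.End.mul_apply,
    LinearMap.smul_apply, LinearMap.smul_apply, Module.End.one_apply]
  simp only [cellOp_apply, map_add, Derivation.leibniz, smul_eq_mul,
    MvPolynomial.smul_eq_C_mul] at h1 h2 ⊢
  rw [← h1]
  have hC : ∀ D : Derivation ℂ BigCell BigCell, D (MvPolynomial.C k) = 0 :=
    fun D => D.map_algebraMap k
  simp only [hC]
  linear_combination (MvPolynomial.C k * p) * h2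

/-! ### The affine module of distributions and its vacuum vector -/

/-- The right action of the affine Lie algebra on functions on the big cell. -/
def cell (k : ℂ) : AffineSl2 →ₗ[ℂ] Module.End ℂ BigCell where
  toFun a := Finsupp.lsum ℂ (cellOp k) (LieAlgebra.LoopAlgebra.toFinsupp ℂ ℤ sl2 a.carrier.1) +
    (TrivialLieModule.equiv ℂ _ ℂ a.carrier.2 : ℂ) • (k • 1)
  map_add' a b := by
    have h1 : (a + b).carrier.1 = a.carrier.1 + b.carrier.1 := rfl
    have h2 : (a + b).carrier.2 = a.carrier.2 + b.carrier.2 := rfl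
    rw [h1, h2, map_add, map_add, map_add, add_smul]
    abel
  map_smul' c a := by
    have h1 : (c • a).carrier.1 = c • a.carrier.1 := rfl
    have h2 : (c • a).carrier.2 = c • a.carrier.2 := rfl
    rw [h1, h2, map_smul, map_smul, map_smul, smul_assoc, smul_add, RingHom.id_apply]

lemma cell_mode (k : ℂ) (x : sl2) (n : ℤ) : cell k (mode x n) = cellOp k n x := by
  change Finsupp.lsum ℂ (cellOp k) (LieAlgebra.LoopAlgebra.toFinsupp ℂ ℤ sl2
    ((AddMonoidAlgebra.single n 1 : AddMonoidAlgebra ℂ ℤ) ⊗ₜ[ℂ] x)) +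
    (TrivialLieModule.equiv ℂ (LieAlgebra.loopAlgebra ℂ ℤ sl2) ℂ 0 : ℂ) • (k • 1) = _
  rw [LieAlgebra.LoopAlgebra.toFinsupp_single_tmul, Finsupp.lsum_single, map_zero, zero_smul,
    add_zero]

lemma cell_central (k : ℂ) : cell k central = k • 1 := by
  change Finsupp.lsum ℂ (cellOp k) (LieAlgebra.LoopAlgebra.toFinsupp ℂ ℤ sl2 0) +
    (TrivialLieModule.equiv ℂ _ ℂ ((TrivialLieModule.equiv ℂ
      (LieAlgebra.loopAlgebra ℂ ℤ sl2) ℂ).symm 1) : ℂ) • (k • 1) = _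
  rw [map_zero, map_zero, LinearEquiv.apply_symm_apply, one_smul, zero_add]

lemma cell_lie (k : ℂ) (a b : AffineSl2) :
    cell k ⁅a, b⁆ = cell k b * cell k a - cell k a * cell k b := by
  induction mode_span a using Submodule.span_induction with
  | zero => simp
  | add a a' _ _ h h' => rw [add_lie, map_add, map_add, h, h', mul_add, add_mul]; abel
  | smul c a _ h => rw [smul_lie, map_smul, map_smul, h, mul_smul_comm, smul_mul_assoc, smul_sub]
  | mem a ha =>
    rcases ha with ⟨x, m, rfl⟩ | ha
    · induction mode_span b using Submodule.span_induction with
      | zero => simp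
      | add a a' _ _ h h' => rw [lie_add, map_add, map_add, h, h', mul_add, add_mul]; abel
      | smul c a _ h =>
        rw [lie_smul, map_smul, map_smul, h, mul_smul_comm, smul_mul_assoc, smul_sub]
      | mem b hb =>
        rcases hb with ⟨y, n, rfl⟩ | hb
        · rw [lie_mode_mode, map_add, map_smul, cell_mode, cell_mode, cell_mode, cell_central,
            cellOp_lie]
        · rw [Set.mem_singleton_iff.mp hb, lie_central, map_zero, cell_central]
          simp
    · rw [Set.mem_singleton_iff.mp ha, ← lie_skew, lie_central, neg_zero, map_zero, cell_central]
      simp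

/-- The action of the affine Lie algebra on distributions on the big cell. -/
def distRep (k : ℂ) : AffineSl2 →ₗ⁅ℂ⁆ Module.End ℂ (Module.Dual ℂ BigCell) where
  toFun a := Module.Dual.transpose (cell k a)
  map_add' a b := by rw [map_add, map_add]
  map_smul' c a := by rw [map_smul, map_smul, RingHom.id_apply]
  map_lie' {a b} := by
    rw [cell_lie, LieRing.of_associative_ring_bracket, map_sub]
    rfl

lemma distRep_apply (k : ℂ) (a : AffineSl2) (φ : Module.Dual ℂ BigCell) (p : BigCell) :
    distRep k a φ p = φ (cell k a p) := rfl

/-- The evaluation of functions at the base point of the big cell. -/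
def evalBase : BigCell →ₐ[ℂ] ℂ := MvPolynomial.aeval fun _ => 0

/-- The delta distribution at the base point of the big cell. -/
def delta : Module.Dual ℂ BigCell := evalBase.toLinearMap

/-- The ideal of the base point of the big cell. -/
def baseIdeal : Ideal BigCell := RingHom.ker evalBase

lemma delta_eq_zero {p : BigCell} (hp : p ∈ baseIdeal) : delta p = 0 := hp

lemma graphProj_mem {p : ℤ} (hp : p < 0) (q : ℤ) (a b : Fin 2) :
    graphProj p q a b ∈ baseIdeal := by
  unfold graphProj
  split_ifs with h1 h2
  · exact zero_mem _
  · omega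
  · omega
  · simp [baseIdeal, evalBase, RingHom.mem_ker]

lemma mul_entry_mem (I : Ideal BigCell) {A B : BigCellMat}
    (h : (∀ a b, A a b ∈ I) ∨ ∀ a b, B a b ∈ I) (a b : Fin 2) : (A * B) a b ∈ I := by
  rw [Matrix.mul_apply]
  refine sum_mem fun c _ => ?_
  rcases h with h | h
  · exact I.mul_mem_right _ (h a c)
  · exact I.mul_mem_left _ (h c b)

lemma traceFun_mem (x : sl2) (n : ℤ) : traceFun x n ∈ baseIdeal := by
  refine sum_mem fun r hr => ?_
  rw [Matrix.trace]
  refine sum_mem fun a _ => mul_entry_mem _ (Or.inr fun a b => ?_) _ _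
  exact graphProj_mem (Finset.mem_Ico.mp hr).2 _ a b

/-- The derivative of the block `(p, q)` along `x tⁿ` at the base point. -/
lemma graphVar_sub_mem (x : BigCellMat) (n : ℤ) {p q : ℤ} (hp : p < 0) (hq : 0 ≤ q)
    (a b : Fin 2) :
    (graphVar x n p q - if p = q + n then x else 0) a b ∈ baseIdeal := by
  have h1 : ∀ c d, (x * graphProj (p - n) q - if p = q + n then x else 0) c d ∈ baseIdeal := by
    intro c d
    rcases lt_or_ge (p - n) 0 with h | h
    · rw [if_neg (by omega), sub_zero]
      exact mul_entry_mem _ (Or.inr fun _ _ => graphProj_mem h _ _ _) _ _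
    · rw [graphProj_of_nonneg h]
      by_cases h' : p = q + n
      · rw [if_pos (by omega), if_pos h', mul_one, sub_self]
        exact zero_mem _
      · rw [if_neg (by omega), if_neg h', mul_zero, sub_zero]
        exact zero_mem _
  have h2 : ∀ c d, (graphProj p (q + n) * x) c d ∈ baseIdeal :=
    mul_entry_mem _ (Or.inl fun _ _ => graphProj_mem hp _ _ _)
  have h3 : ∀ c d, (∑ s ∈ Finset.Ico (-n) 0, graphProj p (s + n) * x * graphProj s q) c d ∈
      baseIdeal := by
    intro c d
    rw [Matrix.sum_apply]
    exact sum_mem fun s hs => mul_entry_mem _ (Or.inr fun _ _ =>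
      graphProj_mem (Finset.mem_Ico.mp hs).2 _ _ _) _ _
  rw [graphVar_of_nonneg _ _ _ hq]
  have := sub_mem (sub_mem (h1 a b) (h2 a b)) (h3 a b)
  convert this using 1
  simp only [Matrix.sub_apply]
  ring

lemma field_X_sub_mem (x : sl2) (n : ℤ) (v : ℕ × ℕ × Fin 2 × Fin 2) :
    field x n (MvPolynomial.X v) -
      MvPolynomial.C (if -(v.1 : ℤ) - 1 = v.2.1 + n then x.1 v.2.2.1 v.2.2.2 else 0) ∈
        baseIdeal := by
  have := graphVar_sub_mem (constMat x) n (p := -(v.1 : ℤ) - 1) (q := v.2.1) (by omega) (by omega)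
    v.2.2.1 v.2.2.2
  rw [field, MvPolynomial.mkDerivation_X]
  convert this using 1
  rw [Matrix.sub_apply]
  congr 1
  split_ifs <;> simp [constMat]

/-- A first-order operator lowers the order of vanishing by at most one. -/
lemma derivation_pow_mem (D : Derivation ℂ BigCell BigCell) (I : Ideal BigCell) (j : ℕ)
    {p : BigCell} (hp : p ∈ I ^ (j + 1)) : D p ∈ I ^ j := by
  induction j generalizing p with
  | zero => simp
  | succ j ih =>
    rw [pow_succ'] at hp
    induction hp using Submodule.mul_induction_on' with
    | mem_mul_mem a ha b hb =>
      rw [Derivation.leibniz, smul_eq_mul, smul_eq_mul]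
      refine add_mem ?_ (Ideal.mul_mem_right _ _ hb)
      rw [pow_succ']
      exact Ideal.mul_mem_mul ha (ih hb)
    | add a _ b _ ha hb => rw [map_add]; exact add_mem ha hb

lemma cellOp_pow_mem (k : ℂ) (x : sl2) (n : ℤ) (j : ℕ) {p : BigCell}
    (hp : p ∈ baseIdeal ^ (j + 1)) : cellOp k n x p ∈ baseIdeal ^ j := by
  rw [cellOp_apply]
  refine add_mem (derivation_pow_mem _ _ _ hp) ?_
  rw [MvPolynomial.smul_eq_C_mul]
  exact Ideal.mul_mem_left _ _ (Ideal.mul_mem_left _ _ (Ideal.pow_le_pow_right j.le_succ hp))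

lemma X_mem_baseIdeal (v : ℕ × ℕ × Fin 2 × Fin 2) :
    (MvPolynomial.X v : BigCell) ∈ baseIdeal := by
  simp [baseIdeal, evalBase, RingHom.mem_ker]

/-- The vector field of `x tⁿ` with `n ≥ 0` vanishes at the base point. -/
lemma field_mem (x : sl2) {n : ℤ} (hn : 0 ≤ n) (p : BigCell) : field x n p ∈ baseIdeal := by
  induction p using MvPolynomial.induction_on with
  | C c => rw [show field x n (MvPolynomial.C c) = 0 from Derivation.map_algebraMap _ c]
           exact zero_mem _
  | add p q hp hq => rw [map_add]; exact add_mem hp hq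
  | mul_X p v hp =>
    rw [Derivation.leibniz, smul_eq_mul, smul_eq_mul]
    refine add_mem (Ideal.mul_mem_left _ _ ?_) (Ideal.mul_mem_right _ _ (X_mem_baseIdeal v))
    have := field_X_sub_mem x n v
    rwa [if_neg (by omega), map_zero, sub_zero] at this

lemma distRep_delta (k : ℂ) (x : sl2) {n : ℤ} (hn : 0 ≤ n) : distRep k (mode x n) delta = 0 := by
  refine LinearMap.ext fun p => ?_
  rw [distRep_apply, cell_mode, cellOp_apply]
  refine delta_eq_zero (add_mem (field_mem x hn p) ?_)
  rw [MvPolynomial.smul_eq_C_mul]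
  exact Ideal.mul_mem_left _ _ (Ideal.mul_mem_right _ _ (traceFun_mem x n))

/-- The homomorphism from the universal affine vertex algebra to distributions on the big cell
taking the vacuum to the delta distribution. -/
def toDist (k : ℂ) : V k →ₗ[ℂ] Module.Dual ℂ BigCell :=
  Submodule.liftQ ((vacuumIdeal k).restrictScalars ℂ)
    ((LinearMap.applyₗ delta).comp (UniversalEnvelopingAlgebra.lift ℂ (distRep k)).toLinearMap) <| by
    -- The annihilator of the delta distribution is a left ideal, so only the generators of the
    -- vacuum ideal have to be tested.
    let J : Submodule U U :=
      { carrier := {u | UniversalEnvelopingAlgebra.lift ℂ (distRep k) u delta = 0}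
        zero_mem' := by simp
        add_mem' := fun {a b} ha hb => by
          simp only [Set.mem_ofPred_eq] at ha hb ⊢
          rw [map_add, LinearMap.add_apply, ha, hb, add_zero]
        smul_mem' := fun c u hu => by
          simp only [Set.mem_ofPred_eq] at hu ⊢
          rw [smul_eq_mul, map_mul, Module.End.mul_apply, hu, map_zero] }
    have hJ : vacuumIdeal k ≤ J := by
      refine Submodule.span_le.mpr ?_
      rintro u (⟨x, n, hn, rfl⟩ | hu)
      · change UniversalEnvelopingAlgebra.lift ℂ (distRep k) _ delta = 0
        rw [UniversalEnvelopingAlgebra.lift_ι_apply]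
        exact distRep_delta k x hn
      · rw [Set.mem_singleton_iff.mp hu]
        change UniversalEnvelopingAlgebra.lift ℂ (distRep k) _ delta = 0
        rw [map_sub, UniversalEnvelopingAlgebra.lift_ι_apply, AlgHom.commutes]
        refine LinearMap.ext fun p => ?_
        rw [LinearMap.sub_apply, LinearMap.sub_apply, distRep_apply, cell_central]
        simp
    intro u hu
    exact hJ hu

lemma toDist_vacuum (k : ℂ) : toDist k (vacuum k) = delta := by
  change UniversalEnvelopingAlgebra.lift ℂ (distRep k) 1 delta = delta
  rw [map_one, Module.End.one_apply]

lemma toDist_op (k : ℂ) (x : sl2) (n : ℤ) (v : V k) (p : BigCell) :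
    toDist k (op k x n v) p = toDist k v (cellOp k n x p) := by
  obtain ⟨u, rfl⟩ := proj_surjective k v
  rw [op, act_apply, ← map_smul, ← cell_mode, ← distRep_apply]
  change UniversalEnvelopingAlgebra.lift ℂ (distRep k) (_ * u) delta p = _
  rw [map_mul, Module.End.mul_apply, UniversalEnvelopingAlgebra.lift_ι_apply]
  rfl

/-! ### Relations of the Chevalley generators and their modes -/

lemma h_val : h.1 = !![1, 0; 0, -1] := by
  rw [h, LieAlgebra.SpecialLinear.val_singleSubSingle]
  ext a b
  fin_cases a <;> fin_cases b <;> simp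

lemma e_val : e.1 = !![0, 1; 0, 0] := by
  change Matrix.single 0 1 1 = _
  ext a b
  fin_cases a <;> fin_cases b <;> simp

lemma f_val : f.1 = !![0, 0; 1, 0] := by
  change Matrix.single 1 0 1 = _
  ext a b
  fin_cases a <;> fin_cases b <;> simp

/-- The basis `h, e, f` of `sl(2)`. -/
def chevalley : Fin 3 → sl2 := ![h, e, f]

lemma eq_chevalley_sum (x : sl2) : x = x.1 0 0 • h + x.1 0 1 • e + x.1 1 0 • f := by
  have hx : x.1 0 0 + x.1 1 1 = 0 := by
    have : Matrix.trace x.1 = 0 := x.2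
    rwa [Matrix.trace_fin_two] at this
  refine Subtype.ext ?_
  change x.1 = x.1 0 0 • h.1 + x.1 0 1 • e.1 + x.1 1 0 • f.1
  rw [h_val, e_val, f_val]
  ext a b
  fin_cases a <;> fin_cases b <;> simp
  linear_combination hx

lemma lie_h_e : ⁅h, e⁆ = (2 : ℂ) • e := by
  refine Subtype.ext ?_
  change _ = (2 : ℂ) • e.1
  rw [LieAlgebra.SpecialLinear.sl_bracket, h_val, e_val]
  ext a b
  fin_cases a <;> fin_cases b <;> norm_num

lemma lie_h_f : ⁅h, f⁆ = (-2 : ℂ) • f := by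
  refine Subtype.ext ?_
  change _ = (-2 : ℂ) • f.1
  rw [LieAlgebra.SpecialLinear.sl_bracket, h_val, f_val]
  ext a b
  fin_cases a <;> fin_cases b <;> norm_num

lemma lie_e_f : ⁅e, f⁆ = h := by
  refine Subtype.ext ?_
  rw [LieAlgebra.SpecialLinear.sl_bracket, h_val, f_val, e_val]
  ext a b
  fin_cases a <;> fin_cases b <;> norm_num

lemma form_h_h : form h h = 2 := by
  rw [form_apply, h_val, Matrix.trace_fin_two]; norm_num

lemma form_h_e : form h e = 0 := by
  rw [form_apply, h_val, e_val, Matrix.trace_fin_two]; norm_num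

lemma form_h_f : form h f = 0 := by
  rw [form_apply, h_val, f_val, Matrix.trace_fin_two]; norm_num

lemma form_e_f : form e f = 1 := by
  rw [form_apply, e_val, f_val, Matrix.trace_fin_two]; norm_num

lemma form_e_e : form e e = 0 := by
  rw [form_apply, e_val, Matrix.trace_fin_two]; norm_num

lemma form_f_f : form f f = 0 := by
  rw [form_apply, f_val, Matrix.trace_fin_two]; norm_num

lemma mode_add (x y : sl2) (n : ℤ) : mode (x + y) n = mode x n + mode y n := by
  refine congrArg (LieAlgebra.ofProd _) (Prod.ext ?_ ?_)
  · exact TensorProduct.tmul_add _ _ _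
  · exact (add_zero _).symm

lemma mode_smul (c : ℂ) (x : sl2) (n : ℤ) : mode (c • x) n = c • mode x n := by
  refine congrArg (LieAlgebra.ofProd _) (Prod.ext ?_ ?_)
  · exact TensorProduct.tmul_smul _ _ _
  · exact (smul_zero _).symm

lemma op_add (k : ℂ) (x y : sl2) (n : ℤ) : op k (x + y) n = op k x n + op k y n := by
  rw [op, mode_add, act_add]; rfl

lemma op_smul (k c : ℂ) (x : sl2) (n : ℤ) : op k (c • x) n = c • op k x n := by
  rw [op, mode_smul, act_smul]; rfl

lemma op_zero (k : ℂ) (n : ℤ) : op k 0 n = 0 := by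
  rw [← zero_smul ℂ (0 : sl2), op_smul, zero_smul]

lemma op_comm (k : ℂ) (x y : sl2) (m n : ℤ) (v : V k) :
    op k x m (op k y n v) = op k y n (op k x m v) + op k ⁅x, y⁆ (m + n) v +
      ((if m + n = 0 then (m : ℂ) * form x y else 0) * k) • v := by
  rw [op, op, act_lie, lie_mode_mode, act_add, act_smul, LinearMap.add_apply, LinearMap.smul_apply,
    act_central, smul_smul, add_assoc]
  rfl

/-! ### Ordered monomials span -/

/-- A subspace containing the vacuum and stable under all modes is everything. -/
lemma eq_top_of_stable (k : ℂ) (S : Submodule ℂ (V k)) (h0 : vacuum k ∈ S)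
    (hS : ∀ (x : sl2) (n : ℤ), ∀ v ∈ S, op k x n v ∈ S) : S = ⊤ := by
  have hact : ∀ (a : AffineSl2) (w : V k), w ∈ S → act k a w ∈ S := by
    intro a w hw
    induction mode_span a using Submodule.span_induction with
    | zero => rw [act_apply, map_zero, zero_smul]; exact zero_mem S
    | add a b _ _ ha hb => rw [act_add]; exact add_mem ha hb
    | smul c a _ ha => rw [act_smul]; exact S.smul_mem c ha
    | mem a ha =>
      rcases ha with ⟨y, m, rfl⟩ | ha
      · exact hS y m w hw
      · rw [Set.mem_singleton_iff.mp ha, act_central]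
        exact S.smul_mem k hw
  have hall : ∀ u ∈ Algebra.adjoin ℂ (Set.range (UniversalEnvelopingAlgebra.ι ℂ : AffineSl2 → U)),
      ∀ w ∈ S, u • w ∈ S := by
    intro u hu
    induction hu using Algebra.adjoin_induction with
    | mem x hx => obtain ⟨a, rfl⟩ := hx; exact hact a
    | algebraMap r => intro w hw; rw [algebraMap_smul]; exact S.smul_mem r hw
    | add x y _ _ hx hy => intro w hw; rw [add_smul]; exact add_mem (hx w hw) (hy w hw)
    | mul x y _ _ hx hy => intro w hw; rw [mul_smul]; exact hx _ (hy w hw)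
  refine eq_top_iff.mpr fun v _ => ?_
  obtain ⟨u, rfl⟩ := proj_surjective k v
  have hv := hall u (adjoin_U ▸ Algebra.mem_top) (vacuum k) h0
  rwa [vacuum, ← map_smul, smul_eq_mul, mul_one] at hv

/-- The index set of the negative modes: `(i, j)` stands for the `i`-th element of `h, e, f`
times `t ^ (-j - 1)`. -/
abbrev Gen : Type := Fin 3 ×ₗ ℕ

/-- The operator attached to an index. -/
def genOp (k : ℂ) (g : Gen) : Module.End ℂ (V k) :=
  op k (chevalley (ofLex g).1) (-((ofLex g).2 : ℤ) - 1)

/-- The vector obtained by applying a word in the negative modes to the vacuum. -/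
def word (k : ℂ) (l : List Gen) : V k := l.foldr (fun g v => genOp k g v) (vacuum k)

lemma word_cons (k : ℂ) (g : Gen) (l : List Gen) : word k (g :: l) = genOp k g (word k l) := rfl

/-- The span of the words of length at most `d`. -/
def filt (k : ℂ) (d : ℕ) : Submodule ℂ (V k) :=
  Submodule.span ℂ (word k '' {l | l.length ≤ d})

lemma word_mem_filt (k : ℂ) {l : List Gen} {d : ℕ} (hl : l.length ≤ d) : word k l ∈ filt k d :=
  Submodule.subset_span ⟨l, hl, rfl⟩

lemma filt_mono (k : ℂ) : Monotone (filt k) := fun _ _ hd =>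
  Submodule.span_mono (Set.image_mono fun _ hl => le_trans hl hd)

lemma filt_induction (k : ℂ) (T : Module.End ℂ (V k)) {d : ℕ} {S : Submodule ℂ (V k)}
    (hT : ∀ l : List Gen, l.length ≤ d → T (word k l) ∈ S) {v : V k} (hv : v ∈ filt k d) :
    T v ∈ S := by
  have : filt k d ≤ S.comap T := Submodule.span_le.mpr (by rintro _ ⟨l, hl, rfl⟩; exact hT l hl)
  exact this hv

lemma genOp_mem_filt (k : ℂ) (g : Gen) {d : ℕ} {v : V k} (hv : v ∈ filt k d) :
    genOp k g v ∈ filt k (d + 1) :=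
  filt_induction k _ (fun l hl => word_mem_filt k (l := g :: l) (by simpa using hl)) hv

lemma op_chevalley_sum (k : ℂ) (x : sl2) (n : ℤ) :
    op k x n = x.1 0 0 • op k (chevalley 0) n + x.1 0 1 • op k (chevalley 1) n +
      x.1 1 0 • op k (chevalley 2) n := by
  conv_lhs => rw [eq_chevalley_sum x]
  rw [op_add, op_add, op_smul, op_smul, op_smul]
  rfl

lemma op_neg_mem_filt (k : ℂ) (x : sl2) {n : ℤ} (hn : n < 0) {d : ℕ} {v : V k}
    (hv : v ∈ filt k d) : op k x n v ∈ filt k (d + 1) := by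
  have key : ∀ i, op k (chevalley i) n v ∈ filt k (d + 1) := by
    intro i
    have := genOp_mem_filt k (toLex (i, (-n - 1).toNat)) hv
    rw [genOp, ofLex_toLex] at this
    convert this using 4
    simp only
    omega
  rw [op_chevalley_sum]
  exact add_mem (add_mem (Submodule.smul_mem _ _ (key 0)) (Submodule.smul_mem _ _ (key 1)))
    (Submodule.smul_mem _ _ (key 2))

/-- The mode is moved to the right until it kills the vacuum. Each commutator replaces two operators
by one mode or a scalar, so the length never exceeds that of the original word. -/
lemma op_nonneg_word (k : ℂ) (l : List Gen) (x : sl2) {n : ℤ} (hn : 0 ≤ n) :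
    op k x n (word k l) ∈ filt k l.length := by
  induction l generalizing x n with
  | nil => rw [word, List.foldr_nil, op_vacuum k x n hn]; exact zero_mem _
  | cons g l ih =>
    rw [word_cons, genOp, op_comm, List.length_cons]
    refine add_mem (add_mem ?_ ?_) ?_
    · exact genOp_mem_filt k g (ih x hn)
    · rcases lt_or_ge (n + (-((ofLex g).2 : ℤ) - 1)) 0 with h | h
      · exact op_neg_mem_filt k _ h (word_mem_filt k le_rfl)
      · exact filt_mono k (Nat.le_succ _) (ih _ h)
    · exact Submodule.smul_mem _ _ (word_mem_filt k (Nat.le_succ _))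

lemma op_mem_filt (k : ℂ) (x : sl2) (n : ℤ) {d : ℕ} {v : V k} (hv : v ∈ filt k d) :
    op k x n v ∈ filt k (d + 1) := by
  rcases lt_or_ge n 0 with h | h
  · exact op_neg_mem_filt k x h hv
  · exact filt_induction k _
      (fun l hl => filt_mono k (hl.trans d.le_succ) (op_nonneg_word k l x h)) hv

lemma exists_mem_filt (k : ℂ) (v : V k) : ∃ d, v ∈ filt k d := by
  have htop : (⨆ d, filt k d) = ⊤ := by
    refine eq_top_of_stable k _ ?_ fun x n v hv => ?_
    · exact Submodule.mem_iSup_of_mem 0 (word_mem_filt k (l := []) le_rfl)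
    · rw [Submodule.mem_iSup_of_directed _ (filt_mono k).directed_le] at hv ⊢
      obtain ⟨d, hd⟩ := hv
      exact ⟨d + 1, op_mem_filt k x n hd⟩
  rw [← Submodule.mem_iSup_of_directed _ (filt_mono k).directed_le, htop]
  trivial

/-- Swapping two neighbours costs a single mode acting on a shorter word. There is no central term,
since two negative mode numbers do not add up to zero. -/
lemma word_perm (k : ℂ) {l l' : List Gen} (hl : l.Perm l') (d : ℕ) (hd : l.length ≤ d + 1) :
    word k l - word k l' ∈ filt k d := by
  induction hl generalizing d with
  | nil => rw [sub_self]; exact zero_mem _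
  | @cons g l l' hl ih =>
    rw [List.length_cons] at hd
    rw [word_cons, word_cons, ← map_sub]
    cases d with
    -- Separate because `genOp_mem_filt` raises the degree by one; a word of length at most one has
    -- no other rearrangement.
    | zero =>
      obtain rfl : l = [] := List.length_eq_zero_iff.mp (by omega)
      rw [List.nil_perm.mp hl, sub_self, map_zero]
      exact zero_mem _
    | succ d => exact genOp_mem_filt k g (ih d (by omega))
  | swap g g' l =>
    simp only [List.length_cons] at hd
    rw [word_cons, word_cons, word_cons, word_cons, genOp, genOp, op_comm, if_neg (by omega)]
    rw [zero_mul, zero_smul, add_zero, add_sub_cancel_left]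
    exact filt_mono k (show l.length + 1 ≤ d by omega) (op_mem_filt k _ _ (word_mem_filt k le_rfl))
  | trans h₁ h₂ ih₁ ih₂ =>
    have := add_mem (ih₁ d hd) (ih₂ d (h₁.length_eq ▸ hd))
    rwa [sub_add_sub_cancel] at this

/-- The ordered monomials in the negative modes, applied to the vacuum. -/
def mon (k : ℂ) (s : Multiset Gen) : V k := word k (s.sort (· ≤ ·))

lemma filt_le_span_mon (k : ℂ) (d : ℕ) :
    filt k d ≤ Submodule.span ℂ (Set.range (mon k)) := by
  induction d with
  | zero =>
    refine Submodule.span_le.mpr ?_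
    rintro _ ⟨l, hl, rfl⟩
    obtain rfl : l = [] := List.length_eq_zero_iff.mp (Nat.le_zero.mp hl)
    exact Submodule.subset_span ⟨0, by simp [mon]⟩
  | succ d ih =>
    refine Submodule.span_le.mpr ?_
    rintro _ ⟨l, hl, rfl⟩
    have hperm : l.Perm ((l : Multiset Gen).sort (· ≤ ·)) :=
      Multiset.coe_eq_coe.mp (Multiset.sort_eq _ _).symm
    have := add_mem (ih (word_perm k hperm d hl))
      (Submodule.subset_span (s := Set.range (mon k)) ⟨l, rfl⟩)
    rwa [mon, sub_add_cancel] at this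

lemma span_mon (k : ℂ) : Submodule.span ℂ (Set.range (mon k)) = ⊤ := by
  refine eq_top_iff.mpr fun v _ => ?_
  obtain ⟨d, hd⟩ := exists_mem_filt k v
  exact filt_le_span_mon k d hd

/-! ### Linear independence of the ordered monomials -/

/-- The coordinate function on the big cell dual to an index. -/
def coord (g : Gen) : BigCell :=
  MvPolynomial.X ((ofLex g).2, 0, ![0, 0, 1] (ofLex g).1, ![0, 1, 0] (ofLex g).1)

lemma chevalley_entry (i i' : Fin 3) :
    (chevalley i).1 (![0, 0, 1] i') (![0, 1, 0] i') = if i = i' then 1 else 0 := by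
  fin_cases i <;> fin_cases i' <;> simp [chevalley, h_val, e_val, f_val]

/-- At X = 0 the element x t^(-j-1) sends t⁰ to t^(-j-1), so among the blocks (i, 0) it moves only i
= j. The matrix entries (0,0), (0,1), (1,0) read off the coefficients of h, e, f. -/
lemma field_coord_sub_mem (g g' : Gen) :
    field (chevalley (ofLex g).1) (-((ofLex g).2 : ℤ) - 1) (coord g') -
      MvPolynomial.C (if g = g' then 1 else 0) ∈ baseIdeal := by
  have := field_X_sub_mem (chevalley (ofLex g).1) (-((ofLex g).2 : ℤ) - 1)
    ((ofLex g').2, 0, ![0, 0, 1] (ofLex g').1, ![0, 1, 0] (ofLex g').1)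
  simp only [chevalley_entry] at this
  suffices hif : (if g = g' then (1 : ℂ) else 0) = if -((ofLex g').2 : ℤ) - 1 =
      ((0 : ℕ) : ℤ) + (-((ofLex g).2 : ℤ) - 1) then if (ofLex g).1 = (ofLex g').1 then 1 else 0
      else 0 by
    rw [hif]
    exact this
  have hg : g = g' ↔ (ofLex g).1 = (ofLex g').1 ∧ (ofLex g).2 = (ofLex g').2 := by
    rw [← Prod.ext_iff, ofLex_inj]
  simp only [hg]
  by_cases h2 : (ofLex g).2 = (ofLex g').2
  · rw [if_pos (c := -((ofLex g').2 : ℤ) - 1 = _) (by rw [h2]; simp)]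
    simp only [h2, and_true]
  · rw [if_neg (c := -((ofLex g').2 : ℤ) - 1 = _) (by push_cast; omega), if_neg (by tauto)]

/-- The product of the coordinate functions in a multiset. -/
def coordProd (s : Multiset Gen) : BigCell := (s.map coord).prod

lemma coordProd_cons (g : Gen) (s : Multiset Gen) :
    coordProd (g ::ₘ s) = coord g * coordProd s := by
  simp [coordProd]

lemma coord_mem (g : Gen) : coord g ∈ baseIdeal := X_mem_baseIdeal _

lemma coordProd_mem (s : Multiset Gen) : coordProd s ∈ baseIdeal ^ s.card := by
  induction s using Multiset.induction_on with
  | empty => simp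
  | cons g s ih =>
    rw [coordProd_cons, Multiset.card_cons, pow_succ']
    exact Ideal.mul_mem_mul (coord_mem g) ih

lemma count_smul_coordProd (g : Gen) (s : Multiset Gen) :
    s.count g • (coord g * coordProd (s.erase g)) = s.count g • coordProd s := by
  by_cases hg : g ∈ s
  · rw [← coordProd_cons, Multiset.cons_erase hg]
  · rw [Multiset.count_eq_zero_of_notMem hg, zero_smul, zero_smul]

/-- To leading order at the base point a negative mode is the partial derivative in its dual
coordinate; the multiplicity times the erased product is that derivative of the monomial. -/
lemma field_coordProd_sub_mem (g : Gen) (s : Multiset Gen) :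
    field (chevalley (ofLex g).1) (-((ofLex g).2 : ℤ) - 1) (coordProd s) -
      s.count g • coordProd (s.erase g) ∈ baseIdeal ^ s.card := by
  induction s using Multiset.induction_on with
  | empty => simp
  | cons a s ih =>
    rw [coordProd_cons, Derivation.leibniz, smul_eq_mul, smul_eq_mul, Multiset.card_cons, pow_succ']
    have h1 := Ideal.mul_mem_mul (coord_mem a) ih
    have h2 := Ideal.mul_mem_mul (field_coord_sub_mem g a) (coordProd_mem s)
    have h3 := add_mem h1 h2
    rw [Multiset.count_cons]
    convert h3 using 1
    by_cases h : g = a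
    · subst h
      have := count_smul_coordProd g s
      rw [if_pos rfl, if_pos rfl, Multiset.erase_cons_head, map_one, add_smul, ← this, one_smul,
        mul_sub,
        mul_smul_comm]
      ring
    · rw [if_neg h, if_neg h, Multiset.erase_cons_tail _ (Ne.symm h), map_zero, add_zero,
        coordProd_cons, mul_sub,
        mul_smul_comm]
      ring

lemma cellOp_coordProd_sub_mem (k : ℂ) (g : Gen) (s : Multiset Gen) :
    cellOp k (-((ofLex g).2 : ℤ) - 1) (chevalley (ofLex g).1) (coordProd s) -
      s.count g • coordProd (s.erase g) ∈ baseIdeal ^ s.card := by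
  rw [cellOp_apply, traceFun_of_nonpos _ (by omega), zero_mul, smul_zero, add_zero]
  exact field_coordProd_sub_mem g s

/-- A word acts as a differential operator at the base point of order at most its length. -/
lemma toDist_word_eq_zero (k : ℂ) (l : List Gen) {p : BigCell}
    (hp : p ∈ baseIdeal ^ (l.length + 1)) : toDist k (word k l) p = 0 := by
  induction l generalizing p with
  | nil =>
    rw [word, List.foldr_nil, toDist_vacuum]
    exact delta_eq_zero (by simpa using hp)
  | cons g l ih =>
    rw [word_cons, genOp, toDist_op]
    exact ih (cellOp_pow_mem k _ _ _ hp)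

lemma toDist_word_cons (k : ℂ) (g : Gen) (l : List Gen) (s : Multiset Gen)
    (hs : s.card = l.length + 1) :
    toDist k (word k (g :: l)) (coordProd s) =
      s.count g * toDist k (word k l) (coordProd (s.erase g)) := by
  have := toDist_word_eq_zero k l (hs ▸ cellOp_coordProd_sub_mem k g s)
  rw [map_sub, sub_eq_zero, map_nsmul, nsmul_eq_mul] at this
  rw [word_cons, genOp, toDist_op, this]

lemma toDist_word_of_ne (k : ℂ) (l : List Gen) (s : Multiset Gen) (hs : s.card = l.length)
    (hne : (l : Multiset Gen) ≠ s) : toDist k (word k l) (coordProd s) = 0 := by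
  induction l generalizing s with
  | nil => exact absurd (Multiset.card_eq_zero.mp hs).symm hne
  | cons g l ih =>
    rw [toDist_word_cons k g l s hs]
    by_cases hg : g ∈ s
    · rw [ih, mul_zero]
      · rw [Multiset.card_erase_of_mem hg, hs]; rfl
      · rintro h
        rw [← Multiset.cons_coe, h, Multiset.cons_erase hg] at hne
        exact hne rfl
    · rw [Multiset.count_eq_zero_of_notMem hg, Nat.cast_zero, zero_mul]

lemma toDist_word_self (k : ℂ) (l : List Gen) : toDist k (word k l) (coordProd l) ≠ 0 := by
  induction l with
  | nil =>
    rw [word, List.foldr_nil, toDist_vacuum]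
    change evalBase (coordProd 0) ≠ 0
    simp [coordProd]
  | cons g l ih =>
    rw [toDist_word_cons k g l _ (by simp), ← Multiset.cons_coe, Multiset.erase_cons_head]
    refine mul_ne_zero (Nat.cast_ne_zero.mpr ?_) ih
    rw [Multiset.count_cons_self]
    exact Nat.succ_ne_zero _

/-- A relation is tested on the coordinate monomial of a longest multiset s in it. Shorter words
vanish there because their order is too small, words of the same length because their symbol is a
different monomial, and the word of s itself gives a nonzero product of multiplicities. -/
lemma linearIndependent_mon (k : ℂ) : LinearIndependent ℂ (mon k) := by
  rw [linearIndependent_iff]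
  intro c hc
  by_contra hne
  obtain ⟨s, hs, hmax⟩ := Finset.exists_max_image c.support Multiset.card
    (Finsupp.support_nonempty_iff.mpr hne)
  have h0 := congrArg (fun v => toDist k v (coordProd s)) hc
  simp only [Finsupp.linearCombination_apply, Finsupp.sum, map_sum, map_smul, LinearMap.sum_apply,
    LinearMap.smul_apply, map_zero, LinearMap.zero_apply] at h0
  rw [Finset.sum_eq_single_of_mem s hs] at h0
  · have h1 := toDist_word_self k (s.sort (· ≤ ·))
    rw [Multiset.sort_eq] at h1
    rcases smul_eq_zero.mp h0 with h | h
    · exact Finsupp.mem_support_iff.mp hs h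
    · exact h1 h
  · intro t ht hts
    have hlen : (t.sort (· ≤ ·)).length = t.card := Multiset.length_sort _
    rcases (hmax t ht).lt_or_eq with h | h
    · rw [mon, toDist_word_eq_zero, smul_zero]
      rw [hlen]
      exact Ideal.pow_le_pow_right h (coordProd_mem s)
    · rw [mon, toDist_word_of_ne, smul_zero]
      · rw [hlen, h]
      · rwa [Multiset.sort_eq]

/-- The Poincaré–Birkhoff–Witt basis of the universal affine vertex algebra. -/
def monBasis (k : ℂ) : Module.Basis (Multiset Gen) ℂ (V k) :=
  Module.Basis.mk (linearIndependent_mon k) (span_mon k).ge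

lemma monBasis_apply (k : ℂ) (s : Multiset Gen) : monBasis k s = mon k s :=
  Module.Basis.mk_apply _ _ s

/-! ### The Sugawara operator grades the modes -/

/-- `op_comm` in the form of a ring identity. -/
lemma op_mul_comm (k : ℂ) (x y : sl2) (m n : ℤ) :
    op k x m * op k y n = op k y n * op k x m + op k ⁅x, y⁆ (m + n) +
      ((if m + n = 0 then (m : ℂ) * form x y else 0) * k) • 1 :=
  LinearMap.ext fun v => op_comm k x y m n v

lemma op_e_f (k : ℂ) (m n : ℤ) :
    op k e m * op k f n = op k f n * op k e m + op k h (m + n) +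
      ((if m + n = 0 then (m : ℂ) else 0) * k) • 1 := by
  rw [op_mul_comm, lie_e_f, form_e_f, mul_one]

lemma op_h_e (k : ℂ) (m n : ℤ) :
    op k h m * op k e n = op k e n * op k h m + (2 : ℂ) • op k e (m + n) := by
  rw [op_mul_comm, lie_h_e, form_h_e, op_smul, mul_zero, ite_self, zero_mul, zero_smul, add_zero]

lemma op_h_f (k : ℂ) (m n : ℤ) :
    op k h m * op k f n = op k f n * op k h m - (2 : ℂ) • op k f (m + n) := by
  rw [op_mul_comm, lie_h_f, form_h_f, op_smul, mul_zero, ite_self, zero_mul, zero_smul, add_zero,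
    neg_smul, sub_eq_add_neg]

lemma op_h_h (k : ℂ) (m n : ℤ) :
    op k h m * op k h n = op k h n * op k h m +
      (if m + n = 0 then (2 * m * k : ℂ) else 0) • 1 := by
  rw [op_mul_comm, lie_self, form_h_h, op_zero, add_zero]
  congr 2
  split_ifs
  · ring
  · ring

/-- With F(n) = e(m-n)h(n) - h(m-n)e(n), the two brackets are F(n) - F(n+m). For m = -1 consecutive
terms cancel, and for m = 0 every term cancels by itself. -/
lemma sugawaraTerm_e (k : ℂ) (n m : ℤ) :
    sugawaraTerm k n * op k e m = op k e m * sugawaraTerm k n +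
      (op k e (m - n) * op k h n - op k h (m - n) * op k e n) -
      (op k e (-n) * op k h (n + m) - op k h (-n) * op k e (n + m)) -
      (((if n = m then (m : ℂ) else 0) + if n = -m then (m : ℂ) else 0) * k) • op k e m := by
  have h1 := op_e_f k m n
  have h2 := op_e_f k m (-n)
  have h3 := op_h_e k n m
  have h4 := op_h_e k (-n) m
  have h5 : op k e (-n) * op k e m = op k e m * op k e (-n) := by
    rw [op_mul_comm, lie_self, form_e_e, op_zero]; simp
  have h6 : op k e n * op k e m = op k e m * op k e n := by
    rw [op_mul_comm, lie_self, form_e_e, op_zero]; simp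
  have c1 : ((if n + m = 0 then (m : ℂ) else 0) * k) • op k e (-n) =
      ((if n = -m then (m : ℂ) else 0) * k) • op k e m := by
    by_cases hn : n = -m
    · subst hn; simp
    · rw [if_neg hn, if_neg (by omega), zero_mul, zero_smul, zero_smul]
  have c2 : ((if m - n = 0 then (m : ℂ) else 0) * k) • op k e n =
      ((if n = m then (m : ℂ) else 0) * k) • op k e m := by
    by_cases hn : n = m
    · subst hn; simp
    · rw [if_neg hn, if_neg (by omega), zero_mul, zero_smul, zero_smul]
  have d1 := congrArg (op k e (-n) * ·) h1
  have d2 := congrArg (· * op k e n) h2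
  have d3 := congrArg (op k h (-n) * ·) h3
  have d4 := congrArg (· * op k h n) h4
  have d5 := congrArg (· * op k f n) h5
  have d6 := congrArg (op k f (-n) * ·) h6
  have e1 : m + -n = m - n := by ring
  have e2 : -n + m = m - n := by ring
  simp only [mul_add, add_mul, mul_smul_comm, smul_mul_assoc, mul_one, one_mul, c1, c2, e1, e2,
    add_comm m n] at d1 d2 d3 d4 d5 d6
  simp only [sugawaraTerm, mul_add, add_mul, mul_smul_comm, smul_mul_assoc, add_smul]
  simp only [← mul_assoc] at d1 d2 d3 d4 d5 d6 ⊢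
  linear_combination (norm := module) -d1 - d2 + (1 / 2 : ℂ) • d3 + (1 / 2 : ℂ) • d4 + d5 + d6

lemma sugawaraTerm_f (k : ℂ) (n m : ℤ) :
    sugawaraTerm k n * op k f m = op k f m * sugawaraTerm k n +
      (op k h (m - n) * op k f n - op k f (m - n) * op k h n) -
      (op k h (-n) * op k f (n + m) - op k f (-n) * op k h (n + m)) -
      (((if n = m then (m : ℂ) else 0) + if n = -m then (m : ℂ) else 0) * k) • op k f m := by
  have h1 := op_e_f k n m
  have h2 := op_e_f k (-n) m
  have h3 := op_h_f k n m
  have h4 := op_h_f k (-n) m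
  have h5 : op k f (-n) * op k f m = op k f m * op k f (-n) := by
    rw [op_mul_comm, lie_self, form_f_f, op_zero]; simp
  have h6 : op k f n * op k f m = op k f m * op k f n := by
    rw [op_mul_comm, lie_self, form_f_f, op_zero]; simp
  have c1 : ((if n + m = 0 then (n : ℂ) else 0) * k) • op k f (-n) =
      -(((if n = -m then (m : ℂ) else 0) * k) • op k f m) := by
    by_cases hn : n = -m
    · subst hn; simp
    · rw [if_neg hn, if_neg (by omega), zero_mul, zero_smul, zero_smul, neg_zero]
  have c2 : ((if m - n = 0 then ((-n : ℤ) : ℂ) else 0) * k) • op k f n =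
      -(((if n = m then (m : ℂ) else 0) * k) • op k f m) := by
    by_cases hn : n = m
    · subst hn; simp
    · rw [if_neg hn, if_neg (by omega), zero_mul, zero_smul, zero_smul, neg_zero]
  have d1 := congrArg (op k f (-n) * ·) h1
  have d2 := congrArg (· * op k f n) h2
  have d3 := congrArg (op k h (-n) * ·) h3
  have d4 := congrArg (· * op k h n) h4
  have d5 := congrArg (· * op k e n) h5
  have d6 := congrArg (op k e (-n) * ·) h6
  have e2 : -n + m = m - n := by ring
  simp only [mul_add, add_mul, mul_sub, sub_mul, mul_smul_comm, smul_mul_assoc, mul_one, one_mul,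
    e2, c1, c2] at d1 d2 d3 d4 d5 d6
  simp only [sugawaraTerm, mul_add, add_mul, mul_smul_comm, smul_mul_assoc, add_smul]
  simp only [← mul_assoc] at d1 d2 d3 d4 d5 d6 ⊢
  linear_combination (norm := module) d1 + d2 + (1 / 2 : ℂ) • d3 + (1 / 2 : ℂ) • d4 + d5 + d6

/-- `2 (k + 2) L(0)`. -/
def sugawara (k : ℂ) : Module.End ℂ (V k) := sugawaraTerm k 0 + (2 : ℂ) • sugawaraSum k

lemma exists_sugawaraSum_eq (k : ℂ) (v : V k) :
    ∃ N₀ : ℕ, ∀ N ≥ N₀, sugawaraSum k v = ∑ n ∈ Finset.range N, sugawaraTerm k (n + 1) v := by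
  obtain ⟨N₀, hN⟩ := locally_finite k v
  refine ⟨N₀, fun N hNN => finsum_eq_sum_of_support_subset _ fun n hn => ?_⟩
  rw [Finset.coe_range, Set.mem_Iio]
  by_contra hlt
  exact hn (by simp [sugawaraTerm, hN _ (n + 1 : ℤ) (by omega)])

/-- The element `x tⁿ` has degree `-n` with respect to `L(0)`. -/
def HasDegree (k : ℂ) (x : sl2) (n : ℤ) : Prop :=
  sugawara k * op k x n = op k x n * sugawara k - (2 * (k + 2) * n : ℂ) • op k x n

lemma HasDegree.add {k : ℂ} {x y : sl2} {n : ℤ} (hx : HasDegree k x n) (hy : HasDegree k y n) :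
    HasDegree k (x + y) n := by
  rw [HasDegree] at *
  rw [op_add, mul_add, add_mul, hx, hy]
  module

lemma HasDegree.smul {k : ℂ} {x : sl2} {n : ℤ} (c : ℂ) (hx : HasDegree k x n) :
    HasDegree k (c • x) n := by
  rw [HasDegree] at *
  rw [op_smul, mul_smul_comm, smul_mul_assoc, hx]
  module

/-- The commutator with the Sugawara operator is a derivation, so degrees add. -/
lemma HasDegree.lie {k : ℂ} {x y : sl2} {m n : ℤ} (hx : HasDegree k x m) (hy : HasDegree k y n) :
    HasDegree k ⁅x, y⁆ (m + n) := by
  rw [HasDegree] at *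
  have h1 := op_mul_comm k x y m n
  have h2 : op k ⁅x, y⁆ (m + n) = op k x m * op k y n - op k y n * op k x m -
      ((if m + n = 0 then (m : ℂ) * form x y else 0) * k) • 1 := by
    rw [h1]; abel
  have a1 := congrArg (· * op k y n) hx
  have a2 := congrArg (op k x m * ·) hy
  have a3 := congrArg (· * op k x m) hy
  have a4 := congrArg (op k y n * ·) hx
  simp only [sub_mul, mul_sub, mul_smul_comm, smul_mul_assoc] at a1 a2 a3 a4
  rw [h2]
  simp only [sub_mul, mul_sub, mul_smul_comm, smul_mul_assoc, mul_one, one_mul, smul_sub]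
  simp only [← mul_assoc] at a1 a2 a3 a4 ⊢
  -- The scalar term of the commutator has no degree of its own: it is absent if m + n ≠ 0, and if m
  -- + n = 0 the required shift is zero.
  by_cases hmn : m + n = 0
  · have : ((m + n : ℤ) : ℂ) = 0 := by rw [hmn, Int.cast_zero]
    have hn : (n : ℂ) = -m := by push_cast at this; linear_combination this
    rw [this]
    rw [hn] at a2 a3
    linear_combination (norm := module) a1 + a2 - a3 - a4
  · rw [if_neg hmn]
    push_cast
    linear_combination (norm := module) a1 + a2 - a3 - a4

/-- The sum of commutators with the terms of the Sugawara operator telescopes. -/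
lemma sugawaraSum_apply (k : ℂ) (X : Module.End ℂ (V k)) (G : ℤ → Module.End ℂ (V k))
    (c : ℂ) (hX : ∀ n : ℕ, sugawaraTerm k (n + 1) * X = X * sugawaraTerm k (n + 1) +
      G (n + 1) - G n - (if n = 0 then c else 0) • X) (v : V k)
    (hG : ∃ N : ℕ, ∀ n : ℤ, N ≤ n → G n v = 0) :
    sugawaraSum k (X v) = X (sugawaraSum k v) - G 0 v - c • X v := by
  obtain ⟨N₁, h₁⟩ := exists_sugawaraSum_eq k v
  obtain ⟨N₂, h₂⟩ := exists_sugawaraSum_eq k (X v)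
  obtain ⟨N₃, h₃⟩ := hG
  set N := N₁ + N₂ + N₃ + 1
  rw [h₁ N (by omega), h₂ N (by omega), map_sum]
  have h4 : ∀ n : ℕ, sugawaraTerm k (n + 1) (X v) = X (sugawaraTerm k (n + 1) v) +
      (G ((n + 1 : ℕ) : ℤ) v - G (n : ℤ) v) - (if n = 0 then c else 0) • X v := by
    intro n
    have := LinearMap.congr_fun (hX n) v
    simp only [Module.End.mul_apply, LinearMap.sub_apply, LinearMap.add_apply,
      LinearMap.smul_apply] at this
    rw [this]
    push_cast
    abel
  have hsum := Finset.sum_range_sub (fun n : ℕ => G (n : ℤ) v) N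
  rw [Finset.sum_congr rfl fun n _ => h4 n, Finset.sum_sub_distrib, Finset.sum_add_distrib,
    hsum, h₃ _ (by omega), ← Finset.sum_smul, Finset.sum_ite_eq' (Finset.range N) 0 fun _ => c,
    if_pos (Finset.mem_range.mpr (by omega))]
  push_cast
  abel

lemma exists_op_mul_sub_eq_zero (k : ℂ) (x y z w : sl2) (m : ℤ) (v : V k) :
    ∃ N : ℕ, ∀ n : ℤ, N ≤ n → (op k x (m - n) * op k y n - op k z (m - n) * op k w n) v = 0 := by
  obtain ⟨N, hN⟩ := locally_finite k v
  exact ⟨N, fun n hn => by simp [hN _ _ hn]⟩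

lemma hasDegree_of_commute (k : ℂ) (x : sl2)
    (hx : ∀ n, sugawaraTerm k n * op k x 0 = op k x 0 * sugawaraTerm k n) :
    HasDegree k x 0 := by
  refine LinearMap.ext fun v => ?_
  have h := sugawaraSum_apply k (op k x 0) (fun _ => 0) 0
    (fun n => by rw [hx]; simp) v ⟨0, fun _ _ => rfl⟩
  have h0 := LinearMap.congr_fun (hx 0) v
  simp only [Module.End.mul_apply] at h0
  simp [sugawara, h, h0]

lemma hasDegree_e_zero (k : ℂ) : HasDegree k e 0 :=
  hasDegree_of_commute k e fun n => by rw [sugawaraTerm_e]; simp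

lemma hasDegree_f_zero (k : ℂ) : HasDegree k f 0 :=
  hasDegree_of_commute k f fun n => by rw [sugawaraTerm_f]; simp

lemma hasDegree_f_one (k : ℂ) : HasDegree k f 1 := by
  refine LinearMap.ext fun v => ?_
  have h := sugawaraSum_apply k (op k f 1)
    (fun n => -(op k h (-n) * op k f (n + 1) - op k f (-n) * op k h (n + 1))) k
    (fun n => by
      rw [sugawaraTerm_f]
      have e1 : (1 : ℤ) - (n + 1) = -n := by ring
      have e2 : ((n : ℤ) + 1 = 1) ↔ n = 0 := by omega
      have e3 : ¬ ((n : ℤ) + 1 = -1) := by omega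
      simp only [e1, e2, e3, if_false, add_zero]
      split_ifs
      · module
      · module) v
    (by
      obtain ⟨N, hN⟩ := locally_finite k v
      exact ⟨N, fun n hn => by simp [hN _ (n + 1) (by omega)]⟩)
  have h0 := LinearMap.congr_fun (sugawaraTerm_f k 0 1) v
  have h1 := LinearMap.congr_fun (op_h_f k 0 1) v
  have h2 := LinearMap.congr_fun (op_h_f k 1 0) v
  simp only [Module.End.mul_apply, LinearMap.sub_apply, LinearMap.add_apply,
    LinearMap.smul_apply, LinearMap.neg_apply, neg_zero, zero_add, add_zero, sub_zero] at h h0 h1 h2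
  rw [if_neg (by norm_num), if_neg (by norm_num)] at h0
  simp only [sugawara, Module.End.mul_apply, LinearMap.sub_apply, LinearMap.add_apply,
    LinearMap.smul_apply, map_add, map_smul]
  rw [h, h0]
  push_cast
  -- The term n = 0 and twice the boundary term of the telescoping combine to [h(0), f(1)] + [h(1),
  -- f(0)] = -4 f(1). Together with -2k f(1) from the sum this is -2(k + 2) f(1).
  linear_combination (norm := module) h1 + h2

lemma hasDegree_e_neg_one (k : ℂ) : HasDegree k e (-1) := by
  refine LinearMap.ext fun v => ?_
  have h := sugawaraSum_apply k (op k e (-1))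
    (fun n => op k e (-1 - n) * op k h n - op k h (-1 - n) * op k e n) (-k)
    (fun n => by
      rw [sugawaraTerm_e]
      have e1 : (-1 : ℤ) - n = -(n + 1) := by ring
      have e2 : ((n : ℤ) + 1 = - -1) ↔ n = 0 := by omega
      have e3 : ¬ ((n : ℤ) + 1 = -1) := by omega
      have e4 : (n : ℤ) + 1 + -1 = n := by ring
      simp only [e1, e2, e3, e4, if_false, zero_add]
      split_ifs
      · module
      · module) v
    (exists_op_mul_sub_eq_zero k _ _ _ _ _ v)
  have h0 := LinearMap.congr_fun (sugawaraTerm_e k 0 (-1)) v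
  have h1 := LinearMap.congr_fun (op_h_e k 0 (-1)) v
  have h2 := LinearMap.congr_fun (op_h_e k (-1) 0) v
  simp only [Module.End.mul_apply, LinearMap.sub_apply, LinearMap.add_apply,
    LinearMap.smul_apply, neg_zero, zero_add, add_zero, sub_zero] at h h0 h1 h2
  rw [if_neg (by norm_num), if_neg (by norm_num)] at h0
  simp only [sugawara, Module.End.mul_apply, LinearMap.sub_apply, LinearMap.add_apply,
    LinearMap.smul_apply, map_add, map_smul]
  rw [h, h0]
  push_cast
  linear_combination (norm := module) h1 + h2

lemma hasDegree_congr {k : ℂ} {x y : sl2} {m n : ℤ} (hx : HasDegree k x m) (hxy : x = y)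
    (hmn : m = n) : HasDegree k y n := hxy ▸ hmn ▸ hx

lemma lie_h_e_half : (1 / 2 : ℂ) • ⁅h, e⁆ = e := by rw [lie_h_e, smul_smul]; norm_num

lemma lie_h_f_half : (-1 / 2 : ℂ) • ⁅h, f⁆ = f := by rw [lie_h_f, smul_smul]; norm_num

lemma hasDegree_step {k : ℂ} {m n : ℤ} (hm : HasDegree k h m ∧ HasDegree k e m ∧ HasDegree k f m)
    (hn : HasDegree k h n ∧ HasDegree k e n ∧ HasDegree k f n) :
    HasDegree k h (m + n) ∧ HasDegree k e (m + n) ∧ HasDegree k f (m + n) :=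
  ⟨hasDegree_congr (hm.2.1.lie hn.2.2) lie_e_f rfl,
    hasDegree_congr ((hm.1.lie hn.2.1).smul _) lie_h_e_half rfl,
    hasDegree_congr ((hm.1.lie hn.2.2).smul _) lie_h_f_half rfl⟩

/-- Only e(0), f(0), f(1), e(-1) are computed directly. Their brackets give all x(1) and x(-1), and
bracketing with these moves n one step up or down. -/
lemma hasDegree (k : ℂ) (x : sl2) (n : ℤ) : HasDegree k x n := by
  have h0 : HasDegree k h 0 :=
    hasDegree_congr ((hasDegree_e_zero k).lie (hasDegree_f_zero k)) lie_e_f (zero_add 0)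
  have hp : HasDegree k h 1 :=
    hasDegree_congr ((hasDegree_e_zero k).lie (hasDegree_f_one k)) lie_e_f (zero_add 1)
  have hm : HasDegree k h (-1) :=
    hasDegree_congr ((hasDegree_e_neg_one k).lie (hasDegree_f_zero k)) lie_e_f (add_zero _)
  have hpe : HasDegree k e 1 :=
    hasDegree_congr ((hp.lie (hasDegree_e_zero k)).smul _) lie_h_e_half (add_zero _)
  have hmf : HasDegree k f (-1) :=
    hasDegree_congr ((hm.lie (hasDegree_f_zero k)).smul _) lie_h_f_half (add_zero _)
  have main : ∀ n : ℤ, HasDegree k h n ∧ HasDegree k e n ∧ HasDegree k f n := by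
    intro n
    induction n using Int.induction_on with
    | zero => exact ⟨h0, hasDegree_e_zero k, hasDegree_f_zero k⟩
    | succ n ih => exact hasDegree_step ih ⟨hp, hpe, hasDegree_f_one k⟩
    | pred n ih => exact hasDegree_step ih ⟨hm, hasDegree_e_neg_one k, hmf⟩
  rw [eq_chevalley_sum x]
  exact (((main n).1.smul _).add ((main n).2.1.smul _)).add ((main n).2.2.smul _)

lemma sugawara_vacuum (k : ℂ) : sugawara k (vacuum k) = 0 := by
  have h1 : ∀ n : ℤ, 0 ≤ n → sugawaraTerm k n (vacuum k) = 0 := by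
    intro n hn
    simp [sugawaraTerm, op_vacuum k _ n hn]
  obtain ⟨N, hN⟩ := exists_sugawaraSum_eq k (vacuum k)
  rw [sugawara, LinearMap.add_apply, LinearMap.smul_apply, h1 0 le_rfl, hN N le_rfl,
    Finset.sum_eq_zero fun n _ => h1 _ (by omega), smul_zero, add_zero]

lemma L0_vacuum (k : ℂ) : L0 k (vacuum k) = 0 := by
  change (1 / (2 * (k + 2)) : ℂ) • sugawara k (vacuum k) = 0
  rw [sugawara_vacuum, smul_zero]

lemma L0_op {k : ℂ} (hk : k ≠ -2) (x : sl2) (n : ℤ) (v : V k) :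
    L0 k (op k x n v) = op k x n (L0 k v) - (n : ℂ) • op k x n v := by
  have hk' : k + 2 ≠ 0 := fun h => hk (eq_neg_of_add_eq_zero_left h)
  have h1 := LinearMap.congr_fun (hasDegree k x n) v
  change (1 / (2 * (k + 2)) : ℂ) • sugawara k (op k x n v) =
    op k x n ((1 / (2 * (k + 2)) : ℂ) • sugawara k v) - _
  simp only [Module.End.mul_apply, LinearMap.sub_apply, LinearMap.smul_apply] at h1
  rw [h1, map_smul, smul_sub, smul_smul]
  congr 2
  field_simp

/-! ### Weight and charge of monomials -/

/-- The conformal weight of a multiset of indices. -/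
def wt (s : Multiset Gen) : ℕ := (s.map fun g => (ofLex g).2 + 1).sum

/-- The charge of a multiset of indices. -/
def charge (s : Multiset Gen) : ℤ := (s.map fun g => (![0, 1, -1] (ofLex g).1 : ℤ)).sum

lemma L0_word {k : ℂ} (hk : k ≠ -2) (l : List Gen) :
    L0 k (word k l) = (wt l : ℂ) • word k l := by
  induction l with
  | nil => rw [word, List.foldr_nil, L0_vacuum]; simp [wt]
  | cons g l ih =>
    rw [word_cons, genOp, L0_op hk, ih, map_smul, ← sub_smul]
    congr 1
    simp only [wt, ← Multiset.cons_coe, Multiset.map_cons, Multiset.sum_cons]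
    push_cast
    ring

lemma h_zero_word (k : ℂ) (l : List Gen) :
    op k h 0 (word k l) = (2 * charge l : ℂ) • word k l := by
  induction l with
  | nil => rw [word, List.foldr_nil, op_vacuum k h 0 le_rfl]; simp [charge]
  | cons g l ih =>
    have hg : ⁅h, chevalley (ofLex g).1⁆ =
        (2 * (![0, 1, -1] (ofLex g).1 : ℤ) : ℂ) • chevalley (ofLex g).1 := by
      generalize (ofLex g).1 = i
      fin_cases i
      · simp [chevalley]
      · simp [chevalley, lie_h_e]
      · simp [chevalley, lie_h_f]
    rw [word_cons, genOp, op_comm, ih, map_smul, hg, op_smul, LinearMap.smul_apply, zero_add,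
      if_neg (by omega), zero_mul, zero_smul, add_zero, ← add_smul]
    congr 1
    simp only [charge, ← Multiset.cons_coe, Multiset.map_cons, Multiset.sum_cons]
    push_cast
    ring

lemma L0_mon {k : ℂ} (hk : k ≠ -2) (s : Multiset Gen) : L0 k (mon k s) = (wt s : ℂ) • mon k s := by
  rw [mon, L0_word hk, Multiset.sort_eq]

lemma h_zero_mon (k : ℂ) (s : Multiset Gen) :
    op k h 0 (mon k s) = (2 * charge s : ℂ) • mon k s := by
  rw [mon, h_zero_word, Multiset.sort_eq]

/-! ### A single oscillator: kernel and range are complementary -/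

section Oscillator

variable {W : Type*} [AddCommGroup W] [Module ℂ W] {a b : Module.End ℂ W} {c : ℂ}

lemma annihilate_pow_succ (hab : a * b = b * a + c • 1) {w : W} (hw : a w = 0) (j : ℕ) :
    a ((b ^ (j + 1)) w) = ((j + 1 : ℕ) * c) • (b ^ j) w := by
  have hab' : ∀ v, a (b v) = b (a v) + c • v := fun v => LinearMap.congr_fun hab v
  induction j with
  | zero => simp [hab', hw]
  | succ j ih =>
    rw [pow_succ', Module.End.mul_apply, hab', ih, map_smul, ← Module.End.mul_apply b, ← pow_succ',
      ← add_smul]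
    congr 1
    push_cast
    ring

/-- Let K be the span of all b^j w with aw = 0. Since a maps K onto K, a vector v with av in K
differs from an element of K by an element of ker a, which lies in K. By induction on the nilpotency
order K is everything, and the terms with j > 0 lie in the range of b. -/
lemma sup_ker_range (hab : a * b = b * a + c • 1) (hc : c ≠ 0)
    (hnil : ∀ v, ∃ m, (a ^ m) v = 0) : LinearMap.ker a ⊔ LinearMap.range b = ⊤ := by
  let K : Submodule ℂ W := Submodule.span ℂ {u | ∃ j w, a w = 0 ∧ u = (b ^ j) w}
  have hlift : K ≤ K.map a := by
    refine Submodule.span_le.mpr ?_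
    rintro _ ⟨j, w, hw, rfl⟩
    refine ⟨(((j + 1 : ℕ) * c)⁻¹ : ℂ) • (b ^ (j + 1)) w,
      K.smul_mem _ (Submodule.subset_span ⟨_, w, hw, rfl⟩), ?_⟩
    rw [map_smul, annihilate_pow_succ hab hw, smul_smul, inv_mul_cancel₀, one_smul]
    exact mul_ne_zero (Nat.cast_ne_zero.mpr j.succ_ne_zero) hc
  have hK : ∀ m v, (a ^ m) v = 0 → v ∈ K := by
    intro m
    induction m with
    | zero => intro v hv; rw [pow_zero, Module.End.one_apply] at hv; rw [hv]; exact zero_mem K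
    | succ m ih =>
      intro v hv
      obtain ⟨y, hy, hya⟩ := hlift (ih (a v) (by rwa [pow_succ] at hv))
      have : v - y ∈ K := Submodule.subset_span ⟨0, v - y, by rw [map_sub, hya, sub_self], rfl⟩
      simpa using add_mem this hy
  have hle : K ≤ LinearMap.ker a ⊔ LinearMap.range b := by
    refine Submodule.span_le.mpr ?_
    rintro _ ⟨j, w, hw, rfl⟩
    cases j with
    | zero => exact Submodule.mem_sup_left hw
    | succ j =>
      rw [pow_succ']
      exact Submodule.mem_sup_right ⟨_, rfl⟩
  refine eq_top_iff.mpr fun v _ => ?_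
  obtain ⟨m, hm⟩ := hnil v
  exact hle (hK m v hm)

/-- If a(bu) = 0, then ba is the nonzero scalar -(j+1)c on a^j u. So a^(j+1) u = 0 forces a^j u = 0,
and local nilpotency descends to u = 0. -/
lemma disjoint_ker_range (hab : a * b = b * a + c • 1) (hc : c ≠ 0)
    (hnil : ∀ v, ∃ m, (a ^ m) v = 0) : Disjoint (LinearMap.ker a) (LinearMap.range b) := by
  have hab' : ∀ v, a (b v) = b (a v) + c • v := fun v => LinearMap.congr_fun hab v
  rw [Submodule.disjoint_def]
  rintro _ hu ⟨u, rfl⟩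
  have hj : ∀ j : ℕ, b (a ((a ^ j) u)) = -((j + 1 : ℕ) * c) • (a ^ j) u := by
    intro j
    induction j with
    | zero =>
      have h1 := hab' u
      rw [LinearMap.mem_ker.mp hu] at h1
      rw [pow_zero, Module.End.one_apply]
      push_cast
      linear_combination (norm := module) -h1
    | succ j ih =>
      have h1 := hab' (a ((a ^ j) u))
      rw [ih, map_smul] at h1
      rw [pow_succ', Module.End.mul_apply]
      push_cast at h1 ⊢
      linear_combination (norm := module) -h1
  have hm : ∀ m, (a ^ m) u = 0 → u = 0 := by
    intro m
    induction m with
    | zero => exact id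
    | succ m ih =>
      intro h
      refine ih ?_
      have h1 := hj m
      rw [← Module.End.mul_apply a, ← pow_succ', h, map_zero] at h1
      refine (smul_eq_zero.mp h1.symm).resolve_left (neg_ne_zero.mpr (mul_ne_zero ?_ hc))
      exact Nat.cast_ne_zero.mpr m.succ_ne_zero
  obtain ⟨m, h⟩ := hnil u
  rw [hm m h, map_zero]

/-- For a locally nilpotent annihilation operator `a` and a creation operator `b`, the projection
onto the kernel of `a` along the range of `b`. -/
lemma exists_projection (hab : a * b = b * a + c • 1) (hc : c ≠ 0)
    (hnil : ∀ v, ∃ m, (a ^ m) v = 0) :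
    ∃ P : Module.End ℂ W, (∀ v, a (P v) = 0) ∧ (∀ v, v - P v ∈ LinearMap.range b) ∧
      (∀ v, P (b v) = 0) ∧ ∀ v, a v = 0 → P v = v := by
  have h : IsCompl (LinearMap.ker a) (LinearMap.range b) :=
    ⟨disjoint_ker_range hab hc hnil, codisjoint_iff.mpr (sup_ker_range hab hc hnil)⟩
  refine ⟨(LinearMap.ker a).subtype ∘ₗ Submodule.projectionOnto _ _ h, ?_, ?_, ?_, ?_⟩
  · intro v
    exact (Submodule.projectionOnto _ _ h v).2
  · intro v
    refine (Submodule.ker_projectionOnto h).le ?_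
    rw [LinearMap.mem_ker, map_sub, LinearMap.comp_apply,
      Submodule.subtype_apply, Submodule.projectionOnto_apply_left, sub_self]
  · intro v
    rw [LinearMap.comp_apply, Submodule.projectionOnto_apply_of_mem_right h ⟨v, rfl⟩, map_zero]
  · intro v hv
    exact congrArg Subtype.val (Submodule.projectionOnto_apply_left h ⟨v, hv⟩)

/-- The projection commutes with all operators preserving kernel and range. -/
lemma projection_commute {P T : Module.End ℂ W} (h1 : ∀ v, a (P v) = 0)
    (h2 : ∀ v, v - P v ∈ LinearMap.range b) (h3 : ∀ v, P (b v) = 0)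
    (h4 : ∀ v, a v = 0 → P v = v) (hT1 : ∀ v, a v = 0 → a (T v) = 0)
    (hT2 : ∀ v, T (b v) ∈ LinearMap.range b) (v : W) : P (T v) = T (P v) := by
  obtain ⟨u, hu⟩ := h2 v
  obtain ⟨u', hu'⟩ := hT2 u
  have hv : v = P v + b u := by rw [hu]; abel
  conv_lhs => rw [hv]
  rw [map_add, map_add, ← hu', h3, add_zero, h4 _ (hT1 _ (h1 v))]

end Oscillator

/-! ### PBW coordinates of eigenvectors and positivity of the weight -/

lemma repr_of_eigenvector {ι W : Type*} [AddCommGroup W] [Module ℂ W] (b : Module.Basis ι ℂ W)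
    (T : Module.End ℂ W) (d : ι → ℂ) (hT : ∀ i, T (b i) = d i • b i) {v : W} {c : ℂ}
    (hv : T v = c • v) {i : ι} (hi : d i ≠ c) : b.repr v i = 0 := by
  have key : (b.coord i).comp T = d i • b.coord i := by
    classical
    refine b.ext fun j => ?_
    simp only [LinearMap.comp_apply, hT, map_smul, LinearMap.smul_apply, Module.Basis.coord_apply,
      Module.Basis.repr_self, smul_eq_mul]
    by_cases h : j = i
    · rw [h]
    · rw [Finsupp.single_eq_of_ne (Ne.symm h), mul_zero, mul_zero]
  have h1 := LinearMap.congr_fun key v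
  simp only [LinearMap.comp_apply, hv, map_smul, LinearMap.smul_apply, Module.Basis.coord_apply,
    smul_eq_mul] at h1
  have h2 : (d i - c) * b.repr v i = 0 := by linear_combination -h1
  exact (mul_eq_zero.mp h2).resolve_left (sub_ne_zero.mpr hi)

lemma repr_eq_zero_of_wt {k : ℂ} (hk : k ≠ -2) {v : V k} {n : ℕ} (hv : L0 k v = (n : ℂ) • v)
    {s : Multiset Gen} (hs : wt s ≠ n) : (monBasis k).repr v s = 0 :=
  repr_of_eigenvector (monBasis k) (L0 k) (fun s => (wt s : ℂ))
    (fun s => by rw [monBasis_apply, L0_mon hk]) hv (Nat.cast_injective.ne hs)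

lemma repr_eq_zero_of_charge {k : ℂ} {v : V k} (hv : op k h 0 v = 0)
    {s : Multiset Gen} (hs : charge s ≠ 0) : (monBasis k).repr v s = 0 :=
  repr_of_eigenvector (monBasis k) (op k h 0) (fun s => (2 * charge s : ℂ))
    (fun s => by rw [monBasis_apply, h_zero_mon]) (c := 0) (by rw [hv, zero_smul])
    (mul_ne_zero two_ne_zero (Int.cast_ne_zero.mpr hs))

lemma eq_zero_of_L0_neg {k : ℂ} (hk : k ≠ -2) {v : V k} {n : ℤ} (hn : n < 0)
    (hv : L0 k v = (n : ℂ) • v) : v = 0 := by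
  refine (monBasis k).repr.injective ?_
  rw [map_zero]
  ext s
  refine repr_of_eigenvector (monBasis k) (L0 k) (fun s => (wt s : ℂ))
    (fun s => by rw [monBasis_apply, L0_mon hk]) hv fun h => ?_
  have : ((wt s : ℤ) : ℂ) = (n : ℂ) := by rw [← h, Int.cast_natCast]
  have := Int.cast_injective this
  omega

lemma L0_op_eigen {k : ℂ} (hk : k ≠ -2) (x : sl2) (m : ℤ) {v : V k} {n : ℤ}
    (hv : L0 k v = (n : ℂ) • v) : L0 k (op k x m v) = ((n - m : ℤ) : ℂ) • op k x m v := by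
  rw [L0_op hk, hv, map_smul, ← sub_smul, Int.cast_sub]

/-- Each application lowers the weight by m ≥ 1, and negative weights do not occur. -/
lemma exists_op_pow_eq_zero {k : ℂ} (hk : k ≠ -2) (x : sl2) {m : ℤ} (hm : 0 < m) (v : V k) :
    ∃ j : ℕ, (op k x m ^ j) v = 0 := by
  have hmon : ∀ s, ∃ j : ℕ, (op k x m ^ j) (mon k s) = 0 := by
    intro s
    have hj : ∀ j : ℕ, L0 k ((op k x m ^ j) (mon k s)) =
        ((wt s - j * m : ℤ) : ℂ) • (op k x m ^ j) (mon k s) := by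
      intro j
      induction j with
      | zero => rw [pow_zero, Module.End.one_apply, L0_mon hk]; simp
      | succ j ih =>
        rw [pow_succ', Module.End.mul_apply, L0_op_eigen hk x m ih]
        congr 2
        push_cast
        ring
    refine ⟨wt s + 1, eq_zero_of_L0_neg hk ?_ (hj _)⟩
    push_cast
    nlinarith
  have hmono : ∀ (j i : ℕ) (w : V k), (op k x m ^ j) w = 0 → (op k x m ^ (i + j)) w = 0 := by
    intro j i w hw
    rw [pow_add, Module.End.mul_apply, hw, map_zero]
  have hv : v ∈ Submodule.span ℂ (Set.range (mon k)) := span_mon k ▸ Submodule.mem_top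
  induction hv using Submodule.span_induction with
  | mem v hv => obtain ⟨s, rfl⟩ := hv; exact hmon s
  | zero => exact ⟨0, map_zero _⟩
  | add v w _ _ hv hw =>
    obtain ⟨i, hi⟩ := hv
    obtain ⟨j, hj⟩ := hw
    exact ⟨i + j, by rw [map_add, hmono j i w hj, add_comm i j, hmono i j v hi, add_zero]⟩
  | smul c v _ hv =>
    obtain ⟨i, hi⟩ := hv
    exact ⟨i, by rw [map_smul, hi, smul_zero]⟩

/-! ### Projections for the Heisenberg modes -/

lemma heisenberg_relation (k : ℂ) (j : ℕ) :
    op k h (j + 1) * op k h (-(j : ℤ) - 1) =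
      op k h (-(j : ℤ) - 1) * op k h (j + 1) + (2 * (j + 1) * k : ℂ) • 1 := by
  rw [op_h_h, if_pos (by ring)]
  push_cast
  rfl

lemma op_h_commute (k : ℂ) {m n : ℤ} (hmn : m + n ≠ 0) (v : V k) :
    op k h m (op k h n v) = op k h n (op k h m v) := by
  have := LinearMap.congr_fun (op_h_h k m n) v
  rwa [if_neg hmn, zero_smul, add_zero] at this

/-- The projection onto the kernel of `h(j + 1)` along the image of `h(-j - 1)`. -/
lemma exists_heisProj {k : ℂ} (hk : k ≠ -2) (hk0 : k ≠ 0) (j : ℕ) :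
    ∃ P : Module.End ℂ (V k), (∀ v, op k h (j + 1) (P v) = 0) ∧
      (∀ v, v - P v ∈ LinearMap.range (op k h (-(j : ℤ) - 1))) ∧
      (∀ v, P (op k h (-(j : ℤ) - 1) v) = 0) ∧
      (∀ v, op k h (j + 1) v = 0 → P v = v) ∧
      (∀ m : ℤ, m ≠ j + 1 → m ≠ -j - 1 → ∀ v, P (op k h m v) = op k h m (P v)) ∧
      ∀ v, P (L0 k v) = L0 k (P v) := by
  have hc : (2 * (j + 1) * k : ℂ) ≠ 0 :=
    mul_ne_zero (mul_ne_zero two_ne_zero (Nat.cast_add_one_ne_zero j)) hk0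
  obtain ⟨P, h1, h2, h3, h4⟩ := exists_projection (heisenberg_relation k j) hc
    (exists_op_pow_eq_zero hk h (by omega))
  refine ⟨P, h1, h2, h3, h4, fun m hm hm' => ?_, ?_⟩
  · refine projection_commute h1 h2 h3 h4 (fun v hv => ?_) fun v => ?_
    · rw [op_h_commute k (by omega), hv, map_zero]
    · exact ⟨_, op_h_commute k (by omega) v⟩
  · refine projection_commute h1 h2 h3 h4 (fun v hv => ?_) fun v => ?_
    · have := L0_op hk h (j + 1) v
      rw [hv, map_zero, smul_zero, sub_zero] at this
      exact this.symm
    · rw [L0_op hk, ← map_smul, ← map_sub]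
      exact ⟨_, rfl⟩

/-- The span of the images of `h(-1), …, h(-M)`. -/
def heisImage (k : ℂ) : ℕ → Submodule ℂ (V k)
  | 0 => ⊥
  | M + 1 => heisImage k M ⊔ LinearMap.range (op k h (-(M : ℤ) - 1))

lemma heisImage_mono (k : ℂ) : Monotone (heisImage k) :=
  monotone_nat_of_le_succ fun _ => le_sup_left

lemma heisImage_map_le {k : ℂ} {M : ℕ} {T : Module.End ℂ (V k)}
    (hT : ∀ j < M, ∀ v, T (op k h (-(j : ℤ) - 1) v) = op k h (-(j : ℤ) - 1) (T v)) {v : V k}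
    (hv : v ∈ heisImage k M) : T v ∈ heisImage k M := by
  induction M generalizing v with
  | zero => rw [(Submodule.mem_bot ℂ).mp hv, map_zero]; exact zero_mem _
  | succ M ih =>
    obtain ⟨y, hy, _, ⟨u, rfl⟩, rfl⟩ := Submodule.mem_sup.mp hv
    rw [map_add, hT M M.lt_succ_self]
    exact add_mem (Submodule.mem_sup_left (ih (fun j hj => hT j (by omega)) hy))
      (Submodule.mem_sup_right ⟨_, rfl⟩)

/-- The projection for the last oscillator fixes v, kills the component in the last image, and
preserves the other images because it commutes with the h(-j-1) for j < M. So v already lies in the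
sum of the first M images. -/
lemma eq_zero_of_mem_heisImage {k : ℂ} (hk : k ≠ -2) (hk0 : k ≠ 0) (M : ℕ) {v : V k}
    (hv : v ∈ heisImage k M) (h0 : ∀ j < M, op k h (j + 1) v = 0) : v = 0 := by
  induction M generalizing v with
  | zero => exact (Submodule.mem_bot ℂ).mp hv
  | succ M ih =>
    obtain ⟨P, -, -, h3, h4, h5, -⟩ := exists_heisProj hk hk0 M
    refine ih ?_ fun j hj => h0 j (by omega)
    obtain ⟨y, hy, _, ⟨u, rfl⟩, hyu⟩ := Submodule.mem_sup.mp hv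
    rw [← h4 v (by exact_mod_cast h0 M M.lt_succ_self), ← hyu, map_add, h3, add_zero]
    exact heisImage_map_le (fun j hj => h5 _ (by omega) (by omega)) hy

/-- The projection onto the common kernel of `h(1), …, h(M)` along the sum of the images of
`h(-1), …, h(-M)`. -/
lemma exists_heisProjs {k : ℂ} (hk : k ≠ -2) (hk0 : k ≠ 0) (M : ℕ) :
    ∃ Q : Module.End ℂ (V k), (∀ j < M, ∀ v, op k h (j + 1) (Q v) = 0) ∧
      (∀ v, v - Q v ∈ heisImage k M) ∧
      (∀ m : ℤ, (m = 0 ∨ M < m) → ∀ v, Q (op k h m v) = op k h m (Q v)) ∧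
      ∀ v, Q (L0 k v) = L0 k (Q v) := by
  induction M with
  | zero =>
    exact ⟨1, fun j hj => absurd hj j.not_lt_zero, fun v => by simp, fun _ _ _ => rfl, fun _ => rfl⟩
  | succ M ih =>
    obtain ⟨Q, q1, q2, q3, q4⟩ := ih
    obtain ⟨P, h1, h2, -, -, h5, h6⟩ := exists_heisProj hk hk0 M
    refine ⟨P * Q, fun j hj v => ?_, fun v => ?_, fun m hm v => ?_, fun v => ?_⟩
    · rcases Nat.lt_succ_iff_lt_or_eq.mp hj with hj | rfl
      · rw [Module.End.mul_apply, ← h5 _ (by omega) (by omega), q1 j hj, map_zero]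
      · exact h1 _
    · have := add_mem (Submodule.mem_sup_left (q2 v)) (Submodule.mem_sup_right (h2 (Q v)) :
        _ ∈ heisImage k M ⊔ LinearMap.range (op k h (-(M : ℤ) - 1)))
      rwa [sub_add_sub_cancel] at this
    · push_cast at hm
      rw [Module.End.mul_apply, q3 m (by omega), h5 m (by omega) (by omega), Module.End.mul_apply]
    · rw [Module.End.mul_apply, q4, h6, Module.End.mul_apply]

/-! ### Parafermion vectors and coefficients at monomials free of h -/

/-- The index of `h t ^ (-j - 1)`. -/
abbrev hGen (j : ℕ) : Gen := toLex (0, j)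

lemma word_orderedInsert (k : ℂ) (j : ℕ) (l : List Gen) :
    word k (l.orderedInsert (· ≤ ·) (hGen j)) = op k h (-(j : ℤ) - 1) (word k l) := by
  induction l with
  | nil => rfl
  | cons g l ih =>
    by_cases hg : hGen j ≤ g
    · rw [List.orderedInsert_cons_of_le _ _ hg]
      rfl
    · obtain ⟨i, hi⟩ : ∃ i, g = hGen i := by
        refine ⟨(ofLex g).2, ?_⟩
        have h1 := Prod.Lex.lt_iff.mp (not_le.mp hg)
        have h2 : (ofLex g).1 = 0 := by
          rcases h1 with h1 | h1
          · exact absurd h1 (Fin.not_lt_zero _)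
          · exact h1.1
        exact ofLex_inj.mp (Prod.ext h2 rfl)
      rw [List.orderedInsert_of_not_le _ _ hg, word_cons, ih, word_cons, hi]
      exact op_h_commute k (by change -(i : ℤ) - 1 + (-(j : ℤ) - 1) ≠ 0; omega) _

/-- Exact, with no lower terms: in the lexicographic order all h's precede e and f, and the negative
modes of h commute, so a further one can be sorted in for free. -/
lemma op_h_mon (k : ℂ) (j : ℕ) (s : Multiset Gen) :
    op k h (-(j : ℤ) - 1) (mon k s) = mon k (hGen j ::ₘ s) := by
  have : (s.sort (· ≤ ·)).orderedInsert (· ≤ ·) (hGen j) =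
      (hGen j ::ₘ s).sort (· ≤ ·) := by
    refine List.Perm.eq_of_pairwise' (r := (· ≤ ·))
      ((Multiset.pairwise_sort _ _).orderedInsert _ _) (Multiset.pairwise_sort _ _) ?_
    refine (List.perm_orderedInsert _ _ _).trans (Multiset.coe_eq_coe.mp ?_)
    rw [← Multiset.cons_coe, Multiset.sort_eq, Multiset.sort_eq]
  rw [mon, ← word_orderedInsert, this, mon]

lemma repr_heisImage {k : ℂ} {M : ℕ} {v : V k} (hv : v ∈ heisImage k M) {s : Multiset Gen}
    (hs : ∀ j, hGen j ∉ s) : (monBasis k).repr v s = 0 := by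
  induction M generalizing v with
  | zero => rw [(Submodule.mem_bot ℂ).mp hv, map_zero]; rfl
  | succ M ih =>
    obtain ⟨y, hy, _, ⟨u, rfl⟩, rfl⟩ := Submodule.mem_sup.mp hv
    have key : ((monBasis k).coord s).comp (op k h (-(M : ℤ) - 1)) = 0 := by
      classical
      refine (monBasis k).ext fun t => ?_
      rw [LinearMap.comp_apply, monBasis_apply, op_h_mon, ← monBasis_apply,
        Module.Basis.coord_apply, Module.Basis.repr_self, Finsupp.single_eq_of_ne,
        LinearMap.zero_apply]
      rintro rfl
      exact hs M (Multiset.mem_cons_self _ _)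
    rw [map_add, Finsupp.add_apply, ih hy, zero_add]
    exact LinearMap.congr_fun key u

lemma mon_mem_heisImage (k : ℂ) {s : Multiset Gen} {j : ℕ} (hs : hGen j ∈ s) :
    mon k s ∈ heisImage k (j + 1) := by
  rw [← Multiset.cons_erase hs, ← op_h_mon]
  exact Submodule.mem_sup_right ⟨_, rfl⟩

lemma exists_mem_heisImage {k : ℂ} {v : V k}
    (hv : ∀ s : Multiset Gen, (∀ j, hGen j ∉ s) → (monBasis k).repr v s = 0) :
    ∃ M, v ∈ heisImage k M := by
  rw [← Submodule.mem_iSup_of_directed _ (heisImage_mono k).directed_le,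
    ← (monBasis k).linearCombination_repr v, Finsupp.linearCombination_apply]
  refine sum_mem fun s hs => Submodule.smul_mem _ _ ?_
  have : ¬ ∀ j, hGen j ∉ s := fun h => Finsupp.mem_support_iff.mp hs (hv s h)
  push Not at this
  obtain ⟨j, hj⟩ := this
  rw [monBasis_apply]
  exact Submodule.mem_iSup_of_mem _ (mon_mem_heisImage k hj)

/-- The multisets indexing a basis of the weight `n` part of the parafermion algebra. -/
def chargeless (n : ℕ) : Set (Multiset Gen) := {s | (∀ j, hGen j ∉ s) ∧ charge s = 0 ∧ wt s = n}

lemma mem_weightSpace (k : ℂ) (n : ℕ) (v : V k) :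
    v ∈ weightSpace k n ↔ (∀ m : ℤ, 0 ≤ m → op k h m v = 0) ∧ L0 k v = (n : ℂ) • v := by
  rw [weightSpace, Submodule.mem_inf, mem_N, Module.End.mem_eigenspace_iff]

/-- The coefficients of a vector of weight `n` in the parafermion algebra. -/
def coeffs (k : ℂ) (n : ℕ) : weightSpace k n →ₗ[ℂ] chargeless n → ℂ :=
  LinearMap.pi fun s => ((monBasis k).coord s).comp (weightSpace k n).subtype

/-- Coefficients of other weight or charge vanish automatically. If the remaining ones free of h
vanish too, the vector lies in the images of the h(-m), which meet the common kernel trivially. -/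
lemma coeffs_injective {k : ℂ} (hk : k ≠ -2) (hk0 : k ≠ 0) (n : ℕ) :
    Function.Injective (coeffs k n) := by
  rw [injective_iff_map_eq_zero]
  rintro ⟨v, hv⟩ h0
  rw [mem_weightSpace] at hv
  refine Subtype.ext ?_
  obtain ⟨M, hM⟩ : ∃ M, v ∈ heisImage k M := by
    refine exists_mem_heisImage fun s hs => ?_
    by_cases h1 : charge s = 0
    · by_cases h2 : wt s = n
      · exact congrFun h0 ⟨s, hs, h1, h2⟩
      · exact repr_eq_zero_of_wt hk hv.2 h2
    · exact repr_eq_zero_of_charge (hv.1 0 le_rfl) h1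
  exact eq_zero_of_mem_heisImage hk hk0 M hM fun j _ => hv.1 _ (by omega)

/-- The combination of monomials with prescribed coefficients is projected into the common kernel;
the correction lies in `heisImage` and has no coefficients free of h. -/
lemma coeffs_surjective {k : ℂ} (hk : k ≠ -2) (hk0 : k ≠ 0) (n : ℕ) [Finite (chargeless n)] :
    Function.Surjective (coeffs k n) := by
  classical
  intro g
  have := Fintype.ofFinite (chargeless n)
  -- Projecting for the first n oscillators is enough: on weight n, h(m) with m > n would lead to
  -- negative weight.
  obtain ⟨Q, q1, q2, q3, q4⟩ := exists_heisProjs hk hk0 n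
  set u : V k := ∑ s : chargeless n, g s • mon k s with hu
  have hL : L0 k u = (n : ℂ) • u := by
    rw [hu, map_sum, Finset.smul_sum]
    refine Finset.sum_congr rfl fun s _ => ?_
    rw [map_smul, L0_mon hk, s.2.2.2, smul_comm]
  have hh : op k h 0 u = 0 := by
    rw [hu, map_sum]
    refine Finset.sum_eq_zero fun s _ => ?_
    rw [map_smul, h_zero_mon, s.2.2.1]
    simp
  have hQL : L0 k (Q u) = (n : ℂ) • Q u := by rw [← q4, hL, map_smul]
  have hmem : Q u ∈ weightSpace k n := by
    rw [mem_weightSpace]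
    refine ⟨fun m hm => ?_, hQL⟩
    rcases hm.eq_or_lt with rfl | hm
    · rw [← q3 0 (Or.inl rfl), hh, map_zero]
    rcases le_or_gt m n with hmn | hmn
    · have := q1 (m - 1).toNat (by omega) u
      rwa [show (((m - 1).toNat : ℕ) : ℤ) + 1 = m by omega] at this
    · refine eq_zero_of_L0_neg hk (n := n - m) (by omega) (L0_op_eigen hk h m ?_)
      rw [hQL, Int.cast_natCast]
  refine ⟨⟨Q u, hmem⟩, ?_⟩
  funext s
  have h1 := repr_heisImage (q2 u) s.2.1
  have h2 : (monBasis k).repr u s = g s := by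
    rw [hu, map_sum, Finsupp.finsetSum_apply, Finset.sum_eq_single s]
    · rw [← monBasis_apply, map_smul, Module.Basis.repr_self, Finsupp.smul_single,
        Finsupp.single_eq_same, smul_eq_mul, mul_one]
    · intro t _ hts
      rw [← monBasis_apply, map_smul, Module.Basis.repr_self, Finsupp.smul_single,
        Finsupp.single_eq_of_ne fun h => hts (Subtype.ext h).symm]
    · exact fun h => absurd (Finset.mem_univ _) h
  rw [map_sub, Finsupp.sub_apply, h2, sub_eq_zero] at h1
  exact h1.symm

/-! ### Counting multisets: the series 1/(q)_m -/

/-- The multisets of `m` natural numbers with sum `i`. -/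
def parts (m i : ℕ) : Set (Multiset ℕ) := {s | s.card = m ∧ s.sum = i}

lemma finite_card_sum_le (m i : ℕ) : {s : Multiset ℕ | s.card ≤ m ∧ s.sum ≤ i}.Finite := by
  refine (Set.finite_Icc (0 : Multiset ℕ) (m • Multiset.range (i + 1))).subset ?_
  rintro s ⟨hm, hi⟩
  refine ⟨Multiset.zero_le _, Multiset.le_iff_count.mpr fun a => ?_⟩
  by_cases ha : a ∈ s
  · have h1 : a ≤ i := (Multiset.single_le_sum (fun _ _ => Nat.zero_le _) a ha).trans hi
    have h2 : 1 ≤ (Multiset.range (i + 1)).count a :=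
      Multiset.one_le_count_iff_mem.mpr (Multiset.mem_range.mpr (by omega))
    rw [Multiset.count_nsmul]
    calc s.count a ≤ m * 1 := by rw [mul_one]; exact (Multiset.count_le_card a s).trans hm
      _ ≤ _ := Nat.mul_le_mul_left m h2
  · rw [Multiset.count_eq_zero_of_notMem ha]
    exact Nat.zero_le _

lemma finite_parts (m i : ℕ) : (parts m i).Finite :=
  (finite_card_sum_le m i).subset fun _ hs => ⟨hs.1.le, hs.2.le⟩

lemma sum_map_succ (s : Multiset ℕ) : (s.map Nat.succ).sum = s.sum + s.card := by
  induction s using Multiset.induction_on with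
  | empty => rfl
  | cons a s ih => simp only [Multiset.map_cons, Multiset.sum_cons, Multiset.card_cons, ih]; omega

/-- Either some part is 0 and one copy is removed, or all m + 1 parts are positive and each is
lowered by one. The condition m + 1 ≤ i guards against truncated subtraction. -/
lemma parts_succ (m i : ℕ) :
    parts (m + 1) i = (0 ::ₘ ·) '' parts m i ∪
      (Multiset.map Nat.succ) '' {s | s ∈ parts (m + 1) (i - (m + 1)) ∧ m + 1 ≤ i} := by
  ext s
  constructor
  · rintro ⟨h1, h2⟩
    by_cases h0 : 0 ∈ s
    · refine Or.inl ⟨s.erase 0, ⟨?_, ?_⟩, Multiset.cons_erase h0⟩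
      · rw [Multiset.card_erase_of_mem h0, h1]; rfl
      · rw [← Multiset.cons_erase h0, Multiset.sum_cons, zero_add] at h2
        exact h2
    · have h3 : (s.map Nat.pred).map Nat.succ = s := by
        rw [Multiset.map_map]
        conv_rhs => rw [← Multiset.map_id s]
        refine Multiset.map_congr rfl fun a ha => Nat.succ_pred ?_
        rintro rfl
        exact h0 ha
      have h4 := sum_map_succ (s.map Nat.pred)
      rw [h3, h2, Multiset.card_map, h1] at h4
      exact Or.inr ⟨s.map Nat.pred, ⟨⟨by rw [Multiset.card_map, h1], by omega⟩, by omega⟩, h3⟩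
  · rintro (⟨t, ⟨h1, h2⟩, rfl⟩ | ⟨t, ⟨⟨h1, h2⟩, h3⟩, rfl⟩)
    · exact ⟨by simp [h1], by simp [h2]⟩
    · exact ⟨by simp [h1], by rw [sum_map_succ, h1, h2]; omega⟩

lemma ncard_parts_succ (m i : ℕ) :
    (parts (m + 1) i).ncard = (parts m i).ncard +
      if m + 1 ≤ i then (parts (m + 1) (i - (m + 1))).ncard else 0 := by
  have hfin : {s | s ∈ parts (m + 1) (i - (m + 1)) ∧ m + 1 ≤ i}.Finite :=
    (finite_parts _ _).subset fun _ hs => hs.1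
  rw [parts_succ, Set.ncard_union_eq _ ((finite_parts _ _).image _) (hfin.image _),
    Set.ncard_image_of_injective _ fun s t h => Multiset.cons_inj_right 0 |>.mp h,
    Set.ncard_image_of_injective _ (Multiset.map_injective Nat.succ_injective)]
  · split_ifs with h
    · simp [h]
    · simp [h]
  · rw [Set.disjoint_left]
    rintro _ ⟨s, _, rfl⟩ ⟨t, _, ht⟩
    have : 0 ∈ t.map Nat.succ := ht ▸ Multiset.mem_cons_self 0 s
    simp at this

/-- The generating function of the multisets of `m` natural numbers. -/
def partsSeries (m : ℕ) : PowerSeries ℚ := PowerSeries.mk fun i => ((parts m i).ncard : ℚ)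

lemma partsSeries_zero : partsSeries 0 = 1 := by
  ext i
  rw [partsSeries, PowerSeries.coeff_mk, PowerSeries.coeff_one]
  by_cases hi : i = 0
  · have : parts 0 i = {0} := by
      ext s
      simp only [parts, Set.mem_ofPred_eq, Multiset.card_eq_zero, Set.mem_singleton_iff]
      exact ⟨fun h => h.1, fun h => ⟨h, by rw [h, hi]; rfl⟩⟩
    rw [this, if_pos hi, Set.ncard_singleton, Nat.cast_one]
  · have : parts 0 i = ∅ := by
      ext s
      simp only [parts, Set.mem_ofPred_eq, Multiset.card_eq_zero, Set.mem_empty_iff_false, iff_false]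
      rintro ⟨rfl, h⟩
      exact hi h.symm
    rw [this, if_neg hi, Set.ncard_empty, Nat.cast_zero]

lemma partsSeries_succ (m : ℕ) :
    partsSeries (m + 1) * (1 - PowerSeries.X ^ (m + 1)) = partsSeries m := by
  ext i
  rw [mul_sub, mul_one, map_sub, PowerSeries.coeff_mul_X_pow', partsSeries, partsSeries,
    PowerSeries.coeff_mk, PowerSeries.coeff_mk, PowerSeries.coeff_mk, ncard_parts_succ]
  split_ifs <;> push_cast <;> ring

lemma partsSeries_mul_qPoch (m : ℕ) : partsSeries m * qPoch m = 1 := by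
  induction m with
  | zero => simp [partsSeries_zero, qPoch]
  | succ m ih =>
    rw [qPoch, Finset.prod_Icc_succ_top (by omega), mul_comm (∏ _ ∈ _, _), ← mul_assoc,
      partsSeries_succ]
    exact ih

lemma inv_qPoch_sq (m : ℕ) : (qPoch m ^ 2)⁻¹ = partsSeries m ^ 2 := by
  have h1 : partsSeries m ^ 2 * qPoch m ^ 2 = 1 := by
    rw [← mul_pow, partsSeries_mul_qPoch, one_pow]
  refine ((PowerSeries.eq_inv_iff_mul_eq_one fun h => ?_).mpr h1).symm
  have h2 := congrArg (PowerSeries.constantCoeff (R := ℚ)) h1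
  rw [map_mul, h, mul_zero, map_one] at h2
  exact zero_ne_one h2

/-- The pairs of multisets of the same cardinality that together have weight `n`. -/
def partPairs (n : ℕ) : Set (Multiset ℕ × Multiset ℕ) :=
  {p | p.1.card = p.2.card ∧ p.1.sum + p.2.sum + 2 * p.1.card = n}

lemma finite_partPairs (n : ℕ) : (partPairs n).Finite := by
  refine ((finite_card_sum_le n n).prod (finite_card_sum_le n n)).subset ?_
  rintro ⟨s, t⟩ ⟨h1, h2⟩
  simp only at h1 h2
  exact ⟨⟨by simp only; omega, by simp only; omega⟩, ⟨by simp only; omega, by simp only; omega⟩⟩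

/-- The factor q^(2m) records that an index j stands for a mode of weight j + 1, over 2m modes. The
rest is the Cauchy product of two series 1/(q)_m. -/
lemma coeff_X_pow_mul_inv (n m : ℕ) :
    PowerSeries.coeff n (PowerSeries.X ^ (2 * m) * (qPoch m ^ 2)⁻¹) =
      (({p | p ∈ partPairs n ∧ p.1.card = m}).ncard : ℚ) := by
  classical
  rw [inv_qPoch_sq, PowerSeries.coeff_X_pow_mul']
  split_ifs with h
  · have hset : {p | p ∈ partPairs n ∧ p.1.card = m} =
        (((Finset.HasAntidiagonal.antidiagonal (n - 2 * m)).biUnion fun ij : ℕ × ℕ =>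
          (finite_parts m ij.1).toFinset ×ˢ (finite_parts m ij.2).toFinset :
            Finset (Multiset ℕ × Multiset ℕ)) : Set (Multiset ℕ × Multiset ℕ)) := by
      ext ⟨s, t⟩
      simp only [partPairs, parts, Set.mem_ofPred_eq, Finset.coe_biUnion, Set.mem_iUnion,
        Finset.mem_coe, Finset.mem_product, Set.Finite.mem_toFinset,
        Finset.HasAntidiagonal.mem_antidiagonal,
        Prod.exists, exists_prop]
      constructor
      · rintro ⟨⟨h1, h2⟩, h3⟩
        exact ⟨s.sum, t.sum, by omega, ⟨h3, rfl⟩, by omega, rfl⟩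
      · rintro ⟨i, j, h1, ⟨h2, h3⟩, h4, h5⟩
        omega
    rw [hset, Set.ncard_coe_finset, Finset.card_biUnion, pow_two, PowerSeries.coeff_mul]
    · push_cast
      refine Finset.sum_congr rfl fun ij _ => ?_
      rw [Finset.card_product, ← Set.ncard_eq_toFinset_card _ (finite_parts m ij.1),
        ← Set.ncard_eq_toFinset_card _ (finite_parts m ij.2), partsSeries, PowerSeries.coeff_mk,
        PowerSeries.coeff_mk, Nat.cast_mul]
    · rintro ⟨i, j⟩ _ ⟨i', j'⟩ _ hne
      rw [Function.onFun, Finset.disjoint_left]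
      rintro ⟨s, t⟩ h1 h2
      simp only [Finset.mem_product, Set.Finite.mem_toFinset, parts, Set.mem_ofPred_eq] at h1 h2
      exact hne (Prod.ext (h1.1.2.symm.trans h2.1.2) (h1.2.2.symm.trans h2.2.2))
  · have : {p | p ∈ partPairs n ∧ p.1.card = m} = ∅ := by
      ext ⟨s, t⟩
      simp only [partPairs, Set.mem_ofPred_eq, Set.mem_empty_iff_false, iff_false]
      rintro ⟨⟨h1, h2⟩, h3⟩
      omega
    rw [this, Set.ncard_empty, Nat.cast_zero]

lemma ncard_partPairs (n : ℕ) :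
    ((partPairs n).ncard : ℚ) = ∑ m ∈ Finset.range (n + 1),
      PowerSeries.coeff n (PowerSeries.X ^ (2 * m) * (qPoch m ^ 2)⁻¹) := by
  classical
  rw [Set.ncard_eq_toFinset_card _ (finite_partPairs n),
    Finset.card_eq_sum_card_fiberwise (f := fun p => p.1.card) (t := Finset.range (n + 1))]
  · push_cast
    refine Finset.sum_congr rfl fun m _ => ?_
    rw [coeff_X_pow_mul_inv, ← Set.ncard_coe_finset]
    congr 2
    ext p
    simp
  · intro p hp
    have h1 := ((finite_partPairs n).mem_toFinset.mp hp).2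
    rw [Finset.coe_range, Set.mem_Iio]
    change p.1.card < n + 1
    omega

/-! ### Monomials of charge zero free of h as pairs of multisets -/

/-- The multiset of indices with given parts of the types `e` and `f`. -/
def ofPair (p : Multiset ℕ × Multiset ℕ) : Multiset Gen :=
  p.1.map (fun j => toLex (1, j)) + p.2.map (fun j => toLex (2, j))

lemma wt_map (i : Fin 3) (s : Multiset ℕ) :
    wt (s.map fun j => toLex (i, j)) = s.sum + s.card := by
  rw [wt, Multiset.map_map, ← sum_map_succ]
  rfl

lemma charge_map (i : Fin 3) (s : Multiset ℕ) :
    charge (s.map fun j => toLex (i, j)) = s.card * (![0, 1, -1] i : ℤ) := by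
  rw [charge, Multiset.map_map]
  change (s.map fun _ => (![0, 1, -1] i : ℤ)).sum = _
  rw [Multiset.map_const', Multiset.sum_replicate, nsmul_eq_mul]

lemma wt_ofPair (p : Multiset ℕ × Multiset ℕ) :
    wt (ofPair p) = p.1.sum + p.1.card + (p.2.sum + p.2.card) := by
  rw [← wt_map 1 p.1, ← wt_map 2 p.2, ofPair, wt, Multiset.map_add, Multiset.sum_add]
  rfl

lemma charge_ofPair (p : Multiset ℕ × Multiset ℕ) :
    charge (ofPair p) = p.1.card - p.2.card := by
  have h1 := charge_map 1 p.1
  have h2 := charge_map 2 p.2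
  simp only [Matrix.cons_val_one, Matrix.cons_val] at h1 h2
  have : charge (ofPair p) = charge (p.1.map fun j => toLex ((1 : Fin 3), j)) +
      charge (p.2.map fun j => toLex ((2 : Fin 3), j)) := by
    rw [ofPair, charge, Multiset.map_add, Multiset.sum_add]
    rfl
  rw [this, h1, h2]
  ring

/-- The parts of a given type in a multiset of indices. -/
def partsOf (i : Fin 3) (s : Multiset Gen) : Multiset ℕ :=
  (s.filter fun g => (ofLex g).1 = i).map fun g => (ofLex g).2

lemma partsOf_add (i : Fin 3) (s t : Multiset Gen) :
    partsOf i (s + t) = partsOf i s + partsOf i t := by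
  simp [partsOf]

lemma partsOf_map (i i' : Fin 3) (s : Multiset ℕ) :
    partsOf i (s.map fun j => toLex (i', j)) = if i' = i then s else 0 := by
  rw [partsOf, Multiset.filter_map, Multiset.map_map]
  split_ifs with h
  · simp [Function.comp_def, h]
  · simp [Function.comp_def, h]

lemma ofPair_partsOf {s : Multiset Gen} (hs : ∀ j, hGen j ∉ s) :
    ofPair (partsOf 1 s, partsOf 2 s) = s := by
  induction s using Multiset.induction_on with
  | empty => rfl
  | cons g s ih =>
    have ih' := ih fun j hj => hs j (Multiset.mem_cons_of_mem hj)
    obtain ⟨i, j, rfl⟩ : ∃ i j, g = toLex (i, j) := ⟨_, _, rfl⟩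
    rw [ofPair] at ih' ⊢
    conv_rhs => rw [← ih']
    rw [← Multiset.singleton_add, partsOf_add, partsOf_add]
    have hi : i = 1 ∨ i = 2 := by
      have : i ≠ 0 := fun h => hs j (by rw [h]; exact Multiset.mem_cons_self _ _)
      omega
    have h1 : ∀ i', partsOf i' ({toLex (i, j)} : Multiset Gen) = if i = i' then {j} else 0 :=
      fun i' => partsOf_map i' i {j}
    rcases hi with rfl | rfl
    · simp [h1]
    · simp [h1]

lemma chargeless_eq (n : ℕ) : chargeless n = ofPair '' partPairs n := by
  ext s
  constructor
  · rintro ⟨h1, h2, h3⟩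
    refine ⟨_, ⟨?_, ?_⟩, ofPair_partsOf h1⟩
    · rw [← ofPair_partsOf h1, charge_ofPair] at h2
      omega
    · rw [← ofPair_partsOf h1, charge_ofPair] at h2
      rw [← ofPair_partsOf h1, wt_ofPair] at h3
      simp only at h2 h3 ⊢
      omega
  · rintro ⟨p, ⟨h1, h2⟩, rfl⟩
    refine ⟨fun j hj => ?_, ?_, ?_⟩
    · simp [ofPair] at hj
    · rw [charge_ofPair, h1, sub_self]
    · rw [wt_ofPair]; omega

lemma ofPair_injective : Function.Injective ofPair := by
  have h : ∀ p, (partsOf 1 (ofPair p), partsOf 2 (ofPair p)) = p := by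
    intro p
    simp [ofPair, partsOf_add, partsOf_map]
  intro p q hpq
  rw [← h p, ← h q, hpq]

lemma finite_chargeless (n : ℕ) : (chargeless n).Finite :=
  chargeless_eq n ▸ (finite_partPairs n).image _

lemma ncard_chargeless (n : ℕ) : (chargeless n).ncard = (partPairs n).ncard := by
  rw [chargeless_eq, Set.ncard_image_of_injective _ ofPair_injective]

/-! ### Dimensions and the weight decomposition -/

/-- The weight `n` part of the parafermion algebra in terms of its coefficients. -/
def coeffsEquiv {k : ℂ} (hk : k ≠ -2) (hk0 : k ≠ 0) (n : ℕ) :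
    weightSpace k n ≃ₗ[ℂ] (chargeless n → ℂ) :=
  have := (finite_chargeless n).to_subtype
  LinearEquiv.ofBijective (coeffs k n) ⟨coeffs_injective hk hk0 n, coeffs_surjective hk hk0 n⟩

lemma finiteDimensional_weightSpace {k : ℂ} (hk : k ≠ -2) (hk0 : k ≠ 0) (n : ℕ) :
    FiniteDimensional ℂ (weightSpace k n) :=
  have := (finite_chargeless n).to_subtype
  Module.Finite.equiv (coeffsEquiv hk hk0 n).symm

lemma finrank_weightSpace {k : ℂ} (hk : k ≠ -2) (hk0 : k ≠ 0) (n : ℕ) :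
    Module.finrank ℂ (weightSpace k n) = (partPairs n).ncard := by
  have := (finite_chargeless n).fintype
  rw [(coeffsEquiv hk hk0 n).finrank_eq, Module.finrank_fintype_fun_eq_card, ← ncard_chargeless,
    ← Nat.card_coe_set_eq, Nat.card_eq_fintype_card]

/-- If eigenvectors of distinct weights sum to zero then each of them vanishes. -/
lemma eq_zero_of_sum_eigen {W : Type*} [AddCommGroup W] [Module ℂ W] (T : Module.End ℂ W)
    {d : ℕ → ℂ} (hd : Function.Injective d) (I : Finset ℕ) (w : ℕ → W)
    (hw : ∀ n ∈ I, T (w n) = d n • w n) (h0 : ∑ n ∈ I, w n = 0) : ∀ n ∈ I, w n = 0 := by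
  have hind : iSupIndep fun n => Module.End.eigenspace T (d n) :=
    (Module.End.eigenspaces_iSupIndep T).comp hd
  exact (iSupIndep_iff_finsetSum_eq_zero_imp_eq_zero _).mp hind I w
    (fun n hn => Module.End.mem_eigenspace_iff.mpr (hw n hn)) h0

/-- Every vector is a finite sum of weight vectors. -/
lemma exists_weight_decomposition {k : ℂ} (hk : k ≠ -2) (v : V k) :
    ∃ (I : Finset ℕ) (w : ℕ → V k), (∀ n, L0 k (w n) = (n : ℂ) • w n) ∧ ∑ n ∈ I, w n = v := by
  classical
  set r := (monBasis k).repr v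
  refine ⟨r.support.image wt, fun n => ∑ s ∈ r.support with wt s = n, r s • mon k s,
    fun n => ?_, ?_⟩
  · rw [map_sum, Finset.smul_sum]
    refine Finset.sum_congr rfl fun s hs => ?_
    rw [map_smul, L0_mon hk, (Finset.mem_filter.mp hs).2, smul_comm]
  · rw [Finset.sum_fiberwise_of_maps_to fun s hs => Finset.mem_image_of_mem wt hs]
    conv_rhs => rw [← (monBasis k).linearCombination_repr v, Finsupp.linearCombination_apply]
    exact Finset.sum_congr rfl fun s _ => congrArg (r s • ·) (monBasis_apply k s).symm

/-- The weight components of v stay in distinct weights after applying h(m), so h(m)v = 0 makes each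
of them a vector killed by h(m). -/
lemma iSup_weightSpace {k : ℂ} (hk : k ≠ -2) : iSup (weightSpace k) = N k := by
  refine le_antisymm (iSup_le fun n => inf_le_left) fun v hv => ?_
  obtain ⟨I, w, hw, rfl⟩ := exists_weight_decomposition hk v
  rw [mem_N] at hv
  refine sum_mem fun n hn => Submodule.mem_iSup_of_mem n ((mem_weightSpace k n _).mpr ⟨?_, hw n⟩)
  intro m hm
  have h0 := hv m hm
  rw [map_sum] at h0
  refine eq_zero_of_sum_eigen (L0 k) (d := fun n => (n : ℂ) - m) (fun a b hab => ?_) I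
    (fun n => op k h m (w n)) (fun n _ => ?_) h0 n hn
  · exact Nat.cast_injective (sub_left_injective hab)
  · have h1 : L0 k (w n) = ((n : ℤ) : ℂ) • w n := by rw [hw, Int.cast_natCast]
    simpa using L0_op_eigen hk h m h1

end Parafermion

end

theorem proposition6p4 (k : ℂ) (hk : k ≠ -2) (hk0 : k ≠ 0) :
    iSup (Parafermion.weightSpace k) = Parafermion.N k ∧
      (∀ n : ℕ, FiniteDimensional ℂ (Parafermion.weightSpace k n)) ∧
      HasSum (fun n : ℕ => PowerSeries.X ^ (2 * n) * ((Parafermion.qPoch n) ^ 2)⁻¹)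
        (Parafermion.ch k) := by
  refine ⟨Parafermion.iSup_weightSpace hk, Parafermion.finiteDimensional_weightSpace hk hk0,
    (PowerSeries.WithPiTopology.hasSum_iff_hasSum_coeff ℚ).mpr fun n => ?_⟩
  rw [Parafermion.ch, PowerSeries.coeff_mk, Parafermion.finrank_weightSpace hk hk0,
    Parafermion.ncard_partPairs]
  -- Only finitely many summands reach a given coefficient: for m > n the summand vanishes to order
  -- 2m > n.
  refine hasSum_sum_of_ne_finset_zero fun m hm => ?_
  rw [Finset.mem_range, not_lt] at hm
  rw [PowerSeries.coeff_X_pow_mul', if_neg (by omega)]
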